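/- Let $\Bbbk$ be an algebraically closed field, let $n\ge 0$, and let $Q$ be a quiver of type $\mathbb{A}_{n+2}$, that is, any orientation of the path graph with vertices $1,2,\dots,n+2$. Let $\operatorname{rep} Q$ be the category of finite-dimensional representations of $Q$ over $\Bbbk$, and write $\operatorname{Ext}=\operatorname{Ext}^1_{\operatorname{rep} Q}$. A representation $T\in\operatorname{rep} Q$ is called basic if it has no repeated direct summands, i.e. there is no indecomposable $A$ such that $A\oplus A$ is isomorphic to a direct summand of $T$. It is called almost rigid if it is basic and, for every pair $A,B$ of indecomposable direct summands of $T$, either $\operatorname{Ext}(A,B)=0$, or $\operatorname{Ext}(A,B)\cong\Bbbk$ and it is generated by the class of a short exact sequence $0\to B\to E\to A\to 0$ whose middle term $E$ is indecomposable. It is called maximal almost rigid if $T$ is almost rigid and $T\oplus M$ is not almost rigid for any nonzero $M\in\operatorname{rep} Q$. Then every maximal almost rigid representation of $Q$ has exactly $2n+3$ indecomposable summands: it is a direct sum of $2n+3$ indecomposable representations, and every decomposition of it into a finite direct sum of indecomposable representations has exactly $2n+3$ terms. Moreover, the number of isomorphism classes of maximal almost rigid representations of $Q$ is the Catalan number $$C_{n+1}=\frac{1}{n+2}\binom{2n+2}{n+1}.$$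 -/

import Mathlib

open CategoryTheory CategoryTheory.Limits CategoryTheory.Abelian

universe u

/-- The vertices `0, 1, …, n + 1` of a quiver of type `𝔸_{n+2}`, labelled in linear order. The
orientation is recorded by `ε`: the `i`-th edge (between the vertices `i` and `i + 1`) points from
`i` to `i + 1` if `ε i = true` and from `i + 1` to `i` if `ε i = false`. -/
def TypeA (n : ℕ) (_ε : Fin (n + 1) → Bool) : Type := Fin (n + 2)

namespace TypeA

/-- The arrows of the quiver of type `𝔸_{n+2}` with orientation `ε`: one for every `i`. -/
inductive Arrow (n : ℕ) (ε : Fin (n + 1) → Bool) : Fin (n + 2) → Fin (n + 2) → Type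
  | right (i : Fin (n + 1)) (h : ε i = true) : Arrow n ε i.castSucc i.succ
  | left (i : Fin (n + 1)) (h : ε i = false) : Arrow n ε i.succ i.castSucc

instance (n : ℕ) (ε : Fin (n + 1) → Bool) : Quiver (TypeA n ε) where
  Hom := Arrow n ε

end TypeA

/-- The category `rep Q` of finite dimensional representations over `k` of a quiver `Q` (with
vertex type `V`): functors from the free category on `Q` to finite dimensional vector spaces, i.e.
a vector space for every vertex and an arbitrary linear map for every arrow. -/
abbrev QuiverRep (k : Type u) [Field k] (V : Type) [Quiver.{0} V] : Type (u + 1) :=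
  Paths V ⥤ FGModuleCat.{u} k

namespace QuiverRep

variable {k : Type u} [Field k] {V : Type} [Quiver.{0} V]

/-- `Ext` groups exist in the abelian category `rep Q` (in a large enough universe). -/
instance : HasExt.{u + 1} (QuiverRep k V) := HasExt.standard _

instance : HasFiniteBiproducts (QuiverRep k V) := Abelian.hasFiniteBiproducts

/-- `A` is (isomorphic to) a direct summand of `T`. -/
def IsSummand (A T : QuiverRep k V) : Prop :=
  ∃ B : QuiverRep k V, Nonempty (T ≅ A ⊞ B)

/-- `T` is basic: it has no repeated indecomposable direct summand. -/
def IsBasic (T : QuiverRep k V) : Prop :=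
  ∀ A : QuiverRep k V, Indecomposable A → ¬ IsSummand (A ⊞ A) T

/-- `Ext(A, B) = k`, and it is generated by the class of a short exact sequence
`0 ⟶ B ⟶ E ⟶ A ⟶ 0` whose middle term `E` is indecomposable. -/
def ExtGeneratedByIndecomposable (A B : QuiverRep k V) : Prop :=
  Module.finrank k (Ext.{u + 1} A B 1) = 1 ∧
  ∃ (E : QuiverRep k V) (i : B ⟶ E) (p : E ⟶ A) (w : i ≫ p = 0)
    (hS : (ShortComplex.mk i p w).ShortExact),
    Indecomposable E ∧ Submodule.span k {(hS.extClass : Ext.{u + 1} A B 1)} = ⊤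

/-- `T` is almost rigid. -/
def IsAlmostRigid (T : QuiverRep k V) : Prop :=
  IsBasic T ∧
  ∀ A B : QuiverRep k V, Indecomposable A → Indecomposable B → IsSummand A T → IsSummand B T →
    Subsingleton (Ext.{u + 1} A B 1) ∨ ExtGeneratedByIndecomposable A B

/-- `T` is maximal almost rigid: it is almost rigid, and `T ⊕ M` is not almost rigid for every
nonzero representation `M`. -/
def IsMaximalAlmostRigid (T : QuiverRep k V) : Prop :=
  IsAlmostRigid T ∧ ∀ M : QuiverRep k V, ¬ IsZero M → ¬ IsAlmostRigid (T ⊞ M)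

/-- `T` is the direct sum of `m` indecomposable representations. -/
def IsSumOfIndecomposables (T : QuiverRep k V) (m : ℕ) : Prop :=
  ∃ M : Fin m → QuiverRep k V, (∀ i, Indecomposable (M i)) ∧ Nonempty (T ≅ ⨁ M)

variable (k V) in
/-- `mar(Q)`: the set of isomorphism classes of maximal almost rigid representations of `Q`. -/
def mar : Set (Quotient (isIsomorphicSetoid (QuiverRep k V))) :=
  {c | ∃ T : QuiverRep k V, IsMaximalAlmostRigid T ∧ Quotient.mk _ T = c}

end QuiverRep

/-!
A representation of `Q` is determined by its spaces, the maps between consecutive spaces being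
linear relations. In a nonzero representation, chains of such relations starting at a vertex, and
dual chains of linear forms that stop at a vertex, single out a longest interval on which the thin
representation splits off. So the indecomposables are the thin representations on intervals, each
with scalar endomorphisms only.

Cut at the ends of its edges, an interval of vertices is a pair of numbers `a < b ≤ n + 2`, that
is, a chord, possibly an edge, of a polygon with `n + 3` vertices; the vertices are arranged by
abscissa, and the arrows of `Q` decide on which side each inner one lies. Presenting `Ext` of two
thin representations by cochains on their common support shows that it is at most one-dimensional,
and that two indecomposables satisfy the condition of almost rigidity in both orders exactly when
their chords do not cross: if the chords cross, the middle term of a nonsplit extension has a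
space of dimension two; if they only meet in an end, it is the third side of a triangle.

Hence the maximal almost rigid representations are the triangulations of the polygon. Splitting off
the triangle at a fixed edge gives the number of chords in each, and the Catalan recurrence.
-/

universe v w

/-! ### Bricks in linear categories -/

section Brick

variable {k : Type*} [Field k] {C : Type*} [Category* C] [Preadditive C] [Linear k C] {X Y : C}

/-- A brick of a `k`-linear category: a nonzero object all of whose endomorphisms are scalar
multiples of the identity. -/
def IsBrick (k : Type*) [Field k] {C : Type*} [Category* C] [Preadditive C] [Linear k C] (X : C) :
    Prop :=
  ¬ IsZero X ∧ ∀ f : X ⟶ X, ∃ c : k, f = c • 𝟙 X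

namespace IsBrick

theorem not_isZero (hX : IsBrick k X) : ¬ IsZero X := hX.1

theorem id_ne_zero (hX : IsBrick k X) : 𝟙 X ≠ 0 := fun h => hX.1 ((IsZero.iff_id_eq_zero X).2 h)

theorem comp_eq_zero_iff (hX : IsBrick k X) {f g : X ⟶ X} : f ≫ g = 0 ↔ f = 0 ∨ g = 0 := by
  obtain ⟨c, rfl⟩ := hX.2 f
  obtain ⟨d, rfl⟩ := hX.2 g
  simp [smul_eq_zero, hX.id_ne_zero, or_comm]

theorem comp_eq_zero_of_comp_eq_zero (hX : IsBrick k X) {f : X ⟶ Y} {g : Y ⟶ X}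
    (h : g ≫ f = 0) : f ≫ g = 0 := by
  have hsq : (f ≫ g) ≫ (f ≫ g) = 0 := by simp [reassoc_of% h]
  exact (hX.comp_eq_zero_iff.1 hsq).elim id id

theorem indecomposable [HasBinaryBiproducts C] (hX : IsBrick k X) : Indecomposable X := by
  refine ⟨hX.not_isZero, fun Y Z e => ?_⟩
  let projY : X ⟶ X := e.hom ≫ biprod.fst ≫ biprod.inl ≫ e.inv
  let projZ : X ⟶ X := e.hom ≫ biprod.snd ≫ biprod.inr ≫ e.inv
  have hcomp : projY ≫ projZ = 0 := by simp [projY, projZ]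
  refine (hX.comp_eq_zero_iff.1 hcomp).imp (fun h => ?_) (fun h => ?_)
  · have : 𝟙 Y = biprod.inl ≫ e.inv ≫ projY ≫ e.hom ≫ biprod.fst := by simp [projY]
    simpa [IsZero.iff_id_eq_zero, h] using this
  · have : 𝟙 Z = biprod.inr ≫ e.inv ≫ projZ ≫ e.hom ≫ biprod.snd := by simp [projZ]
    simpa [IsZero.iff_id_eq_zero, h] using this

end IsBrick

end Brick

section Biproducts

variable {C : Type*} [Category* C] [Preadditive C] {X Y : C}

/-- Adding one summand to a direct sum. -/
noncomputable def biproductOptionIso [HasBinaryBiproducts C] [HasFiniteBiproducts C]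
    {J : Type*} [Finite J] (F : Option J → C) : F none ⊞ (⨁ fun j => F (some j)) ≅ ⨁ F where
  hom := biprod.desc (biproduct.ι F none) (biproduct.desc fun j => biproduct.ι F (some j))
  inv := biproduct.desc fun
    | none => biprod.inl
    | some j => biproduct.ι (fun j => F (some j)) j ≫ biprod.inr
  hom_inv_id := by
    apply biprod.hom_ext'
    · simp
    · exact biproduct.hom_ext' _ _ fun j => by simp
  inv_hom_id := biproduct.hom_ext' _ _ fun
    | none => by simp
    | some j => by simp

theorem comp_eq_sum_biproduct {J : Type} [Fintype J] {F : J → C} [HasBiproduct F]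
    (f : X ⟶ ⨁ F) (g : ⨁ F ⟶ Y) :
    f ≫ g = ∑ j, (f ≫ biproduct.π F j) ≫ biproduct.ι F j ≫ g := by
  conv_lhs => rw [← Category.id_comp g, ← biproduct.total, Preadditive.sum_comp,
    Preadditive.comp_sum]
  simp only [Category.assoc]

end Biproducts

/-! ### Degree one `Ext` and short exact sequences -/

section Effaceable

open HomologicalComplex DerivedCategory

variable {C : Type u} [Category.{v} C] [Abelian C]

theorem exists_epi_comp_eq_single_map {K : CochainComplex C ℤ} {A : C} {i : ℤ} [K.IsStrictlyLE i]
    (π : K ⟶ (CochainComplex.singleFunctor C i).obj A) [QuasiIsoAt π i] :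
    ∃ (α : K.X i ⟶ A) (ζ : (CochainComplex.singleFunctor C i).obj (K.X i) ⟶ K),
      Epi α ∧ ζ ≫ π = (CochainComplex.singleFunctor C i).map α := by
  dsimp only [CochainComplex.singleFunctor, CochainComplex.singleFunctors] at π ‹QuasiIsoAt π i› ⊢
  have hd : K.d i (i + 1) = 0 := (K.isZero_of_isStrictlyLE i (i + 1) (by simp)).eq_of_tgt _ _
  let e := K.iCyclesIso i (i + 1) (by simp) hd
  let α := e.inv ≫ K.homologyπ i ≫ homologyMap π i ≫ (singleObjHomologySelfIso _ _ _).hom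
  have hα : π.f i = α ≫ (singleObjXSelf (ComplexShape.up ℤ) i A).inv := by
    rw [← cancel_epi e.hom]
    dsimp only [α, e]
    rw [Category.assoc, Category.assoc, Category.assoc, Iso.hom_inv_id_assoc,
      homologyπ_naturality_assoc, iCyclesIso_hom,
      homologyπ_singleObjHomologySelfIso_hom_assoc,
      ← singleObjCyclesSelfIso_inv_iCycles, Iso.hom_inv_id_assoc, ← cyclesMap_i]
  refine ⟨α, mkHomFromSingle (𝟙 _) ?_, epi_comp _ _, ?_⟩
  · rintro _ rfl
    rw [hd, comp_zero]
  · apply HomologicalComplex.from_single_hom_ext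
    rw [comp_f, mkHomFromSingle_f, hα, single_map_f_self]
    simp

theorem exists_epi_singleFunctor_map_comp_eq_zero [HasDerivedCategory.{w} C] {A : C}
    {L : CochainComplex C ℤ} {i : ℤ}
    (φ : Q.obj ((CochainComplex.singleFunctor C i).obj A) ⟶ Q.obj L)
    (n : ℤ) (hn : n < i) [L.IsStrictlyLE n] :
    ∃ (Z : C) (p : Z ⟶ A), Epi p ∧ Q.map ((CochainComplex.singleFunctor C i).map p) ≫ φ = 0 := by
  obtain ⟨K, _, π, hπ, g, rfl⟩ := right_fac_of_isStrictlyLE φ i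
  rw [isIso_Q_map_iff_quasiIso] at hπ
  have : QuasiIsoAt π i := hπ.quasiIsoAt i
  obtain ⟨α, ζ, hα, hζ⟩ := exists_epi_comp_eq_single_map π
  have hg : ζ ≫ g = 0 := by
    apply HomologicalComplex.from_single_hom_ext
    apply (L.isZero_of_isStrictlyLE n i hn).eq_of_tgt
  refine ⟨K.X i, α, hα, ?_⟩
  rw [← hζ, Q.map_comp, Category.assoc, IsIso.hom_inv_id_assoc, ← Q.map_comp, hg, Q.map_zero]

theorem exists_epi_mk₀_comp_eq_zero [HasExt.{w} C] {A B : C} {n : ℕ} (x : Ext A B (n + 1)) :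
    ∃ (Z : C) (p : Z ⟶ A), Epi p ∧ (Ext.mk₀ p).comp x (zero_add _) = 0 := by
  let := HasDerivedCategory.standard C
  obtain ⟨Z, p, hp, h⟩ := exists_epi_singleFunctor_map_comp_eq_zero
    (L := (CochainComplex.singleFunctor C (-(n + 1))).obj B)
    (Ext.homEquiv x ≫ ((singleFunctors C).shiftIso (n + 1) (-(n + 1)) 0 (by lia)).hom.app _)
    (-(n + 1)) (by lia)
  refine ⟨Z, p, hp, ?_⟩
  ext
  simp only [← cancel_mono (((singleFunctors C).shiftIso (n + 1) (-(n + 1)) 0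
    (by lia)).hom.app _), Limits.zero_comp, Ext.comp_hom, Ext.mk₀_hom, Ext.zero_hom,
    ShiftedHom.mk₀_comp, Category.assoc]
  exact h

end Effaceable

section ExtOne

variable {C : Type u} [Category.{v} C] [Abelian C]

theorem exists_shortExact_pushout {S : ShortComplex C} (hS : S.ShortExact) {B : C}
    (f : S.X₁ ⟶ B) : ∃ (E : C) (i : B ⟶ E) (p : E ⟶ S.X₃) (w : i ≫ p = 0) (q : S.X₂ ⟶ E),
      (ShortComplex.mk i p w).ShortExact ∧ f ≫ i = S.f ≫ q ∧ q ≫ p = S.g := by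
  have := hS.mono_f
  have := hS.epi_g
  let p : pushout f S.f ⟶ S.X₃ := pushout.desc 0 S.g (by simp)
  have hinr : pushout.inr f S.f ≫ p = S.g := pushout.inr_desc _ _ _
  have hinl : pushout.inl f S.f ≫ p = 0 := pushout.inl_desc _ _ _
  have : Epi p := epi_of_epi_fac hinr
  refine ⟨_, pushout.inl f S.f, p, hinl, pushout.inr f S.f, ?_, pushout.condition, hinr⟩
  refine { exact := ShortComplex.exact_of_g_is_cokernel _ (CokernelCofork.IsColimit.ofπ' _ _ ?_) }
  intro W g hg
  have hfg : S.f ≫ pushout.inr f S.f ≫ g = 0 := by rw [← pushout.condition_assoc, hg, comp_zero]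
  refine ⟨hS.exact.desc (pushout.inr f S.f ≫ g) hfg, pushout.hom_ext ?_ ?_⟩
  · rw [reassoc_of% hinl, zero_comp, hg]
  · rw [reassoc_of% hinr, hS.exact.g_desc]

variable [HasExt.{w} C] {A A' B B' : C}

theorem exists_extClass_eq (x : Ext A B 1) :
    ∃ (E : C) (i : B ⟶ E) (p : E ⟶ A) (w : i ≫ p = 0)
      (hS : (ShortComplex.mk i p w).ShortExact), hS.extClass = x := by
  obtain ⟨Z, p, hp, hx⟩ := exists_epi_mk₀_comp_eq_zero (n := 0) x
  have hK : (ShortComplex.mk _ _ (kernel.condition p)).ShortExact :=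
    { exact := ShortComplex.exact_kernel p }
  obtain ⟨y, rfl⟩ := Ext.contravariant_sequence_exact₃ hK B x hx (n₀ := 0) rfl
  obtain ⟨f, rfl⟩ := (Ext.mk₀_bijective _ _).2 y
  obtain ⟨E, i, q, w, r, hS, h₁, h₃⟩ := exists_shortExact_pushout hK f
  have := ShortComplex.ShortExact.extClass_naturality hK hS
    { τ₁ := f, τ₂ := r, τ₃ := 𝟙 A, comm₁₂ := h₁, comm₂₃ := by simp [h₃] }
  exact ⟨E, i, q, w, hS, by simpa using this.symm⟩

theorem extClass_eq_zero_iff_exists_section {S : ShortComplex C} (hS : S.ShortExact) :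
    (hS.extClass : Ext S.X₃ S.X₁ 1) = 0 ↔ ∃ s : S.X₃ ⟶ S.X₂, s ≫ S.g = 𝟙 _ := by
  constructor
  · intro h
    obtain ⟨y, hy⟩ := Ext.covariant_sequence_exact₃ S.X₃ hS (Ext.mk₀ (𝟙 _)) (n₁ := 1) rfl
      (by simp [h])
    obtain ⟨s, rfl⟩ := (Ext.mk₀_bijective _ _).2 y
    exact ⟨s, (Ext.mk₀_bijective _ _).1 (by rw [← hy, Ext.mk₀_comp_mk₀])⟩
  · rintro ⟨s, hs⟩
    rw [← Ext.mk₀_id_comp (hS.extClass : Ext S.X₃ S.X₁ 1), ← hs, ← Ext.mk₀_comp_mk₀_assoc,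
      hS.comp_extClass, Ext.comp_zero]

theorem subsingleton_ext_one_iff : Subsingleton (Ext A B 1) ↔
    ∀ (E : C) (i : B ⟶ E) (p : E ⟶ A) (w : i ≫ p = 0),
      (ShortComplex.mk i p w).ShortExact → ∃ s : A ⟶ E, s ≫ p = 𝟙 A := by
  constructor
  · exact fun _ E i p w hS => (extClass_eq_zero_iff_exists_section hS).1 (Subsingleton.elim _ _)
  · refine fun h => subsingleton_of_forall_eq 0 fun x => ?_
    obtain ⟨E, i, p, w, hS, rfl⟩ := exists_extClass_eq x
    exact (extClass_eq_zero_iff_exists_section hS).2 (h E i p w hS)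

/-- The linear equivalence on `Ext` groups induced by isomorphisms of both arguments. -/
noncomputable def extLinearEquivOfIso (k : Type*) [CommRing k] [Linear k C] (e : A ≅ A')
    (f : B ≅ B') (n : ℕ) : Ext A B n ≃ₗ[k] Ext A' B' n where
  toFun x := (Ext.mk₀ e.inv).comp (x.comp (Ext.mk₀ f.hom) (add_zero n)) (zero_add n)
  invFun x := (Ext.mk₀ e.hom).comp (x.comp (Ext.mk₀ f.inv) (add_zero n)) (zero_add n)
  map_add' x y := by simp
  map_smul' c x := by simp
  left_inv x := by simp
  right_inv x := by simp

end ExtOne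

/-! ### Representations as spaces and linear maps -/

namespace QuiverRep

section Basic

variable {k : Type u} [Field k] {V : Type} [Quiver.{0} V]

/-- The vector space of a representation at a vertex. -/
abbrev space (X : QuiverRep k V) (v : V) : Type u := X.obj ((Paths.of V).obj v)

/-- The linear map of a representation at an arrow. -/
def act (X : QuiverRep k V) {s t : V} (α : s ⟶ t) : space X s →ₗ[k] space X t :=
  (X.map ((Paths.of V).map α)).hom.hom

/-- The linear map of a morphism of representations at a vertex. -/
def lin {X Y : QuiverRep k V} (f : X ⟶ Y) (v : V) : space X v →ₗ[k] space Y v :=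
  (f.app ((Paths.of V).obj v)).hom.hom

variable {X Y Z : QuiverRep k V}

theorem lin_act (f : X ⟶ Y) {s t : V} (α : s ⟶ t) (x : space X s) :
    lin f t (act X α x) = act Y α (lin f s x) :=
  congrArg (fun g => g.hom.hom x) (f.naturality ((Paths.of V).map α))

@[simp] theorem lin_comp (f : X ⟶ Y) (g : Y ⟶ Z) (v : V) (x : space X v) :
    lin (f ≫ g) v x = lin g v (lin f v x) := rfl

@[simp] theorem lin_id (v : V) (x : space X v) : lin (𝟙 X) v x = x := rfl

@[simp] theorem lin_zero (v : V) (x : space X v) : lin (0 : X ⟶ Y) v x = 0 := rfl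

@[simp] theorem lin_smul (c : k) (f : X ⟶ Y) (v : V) (x : space X v) :
    lin (c • f) v x = c • lin f v x := rfl

theorem hom_ext {f g : X ⟶ Y} (h : ∀ v x, lin f v x = lin g v x) : f = g := by
  apply NatTrans.ext
  funext v
  apply FGModuleCat.hom_ext
  ext x
  exact h v x

/-- The morphism of representations given by linear maps that commute with the arrows. -/
def homMk (f : ∀ v, space X v →ₗ[k] space Y v)
    (hf : ∀ {s t : V} (α : s ⟶ t) (x : space X s), f t (act X α x) = act Y α (f s x)) :
    X ⟶ Y :=
  let φ (v : Paths V) : X.obj v ⟶ Y.obj v := InducedCategory.homMk (ModuleCat.ofHom (f v))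
  { app := φ
    naturality := by
      intro a b p
      induction p using Paths.induction with
      | id => rw [X.map_id, Y.map_id, Category.id_comp, Category.comp_id]
      | comp p q hp =>
        have hq : X.map ((Paths.of V).map q) ≫ φ _ = φ _ ≫ Y.map ((Paths.of V).map q) := by
          apply FGModuleCat.hom_ext
          ext x
          exact hf q x
        rw [Functor.map_comp, Functor.map_comp, Category.assoc, hq, ← Category.assoc, hp,
          Category.assoc] }

@[simp] theorem lin_homMk (f : ∀ v, space X v →ₗ[k] space Y v)
    (hf : ∀ {s t : V} (α : s ⟶ t) (x : space X s), f t (act X α x) = act Y α (f s x))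
    (v : V) (x : space X v) : lin (homMk f hf) v x = f v x := rfl

/-- The representation with given vector spaces and linear maps. -/
def of (S : V → Type u) [∀ v, AddCommGroup (S v)] [∀ v, Module k (S v)]
    [∀ v, Module.Finite k (S v)] (m : ∀ {s t : V}, (s ⟶ t) → (S s →ₗ[k] S t)) :
    QuiverRep k V :=
  Paths.lift { obj := fun v => FGModuleCat.of k (S v), map := fun α => FGModuleCat.ofHom (m α) }

theorem act_of (S : V → Type u) [∀ v, AddCommGroup (S v)] [∀ v, Module k (S v)]
    [∀ v, Module.Finite k (S v)] (m : ∀ {s t : V}, (s ⟶ t) → (S s →ₗ[k] S t))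
    {s t : V} (α : s ⟶ t) (x : S s) : act (of S m) α x = m α x :=
  congrArg (fun g => g.hom.hom x) (Paths.lift_toPath
    { obj := fun v => FGModuleCat.of k (S v), map := fun α => FGModuleCat.ofHom (m α) } α)

theorem epi_of_surjective (f : X ⟶ Y) (h : ∀ v, Function.Surjective (lin f v)) : Epi f where
  left_cancellation _ _ hab := by
    refine hom_ext fun v y => ?_
    obtain ⟨x, rfl⟩ := h v y
    exact congrArg (fun g => lin g v x) hab

theorem mono_of_injective (f : X ⟶ Y) (h : ∀ v, Function.Injective (lin f v)) : Mono f where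
  right_cancellation _ _ hab :=
    hom_ext fun v y => h v (congrArg (fun g => lin g v y) hab)

theorem isZero_iff : IsZero X ↔ ∀ v, Subsingleton (space X v) := by
  rw [IsZero.iff_id_eq_zero]
  constructor
  · exact fun h v => subsingleton_of_forall_eq 0 fun x => congrArg (fun f => lin f v x) h
  · exact fun h => hom_ext fun v x => Subsingleton.elim _ _

theorem not_isZero_iff : ¬ IsZero X ↔ ∃ v, Nontrivial (space X v) := by
  simp only [isZero_iff, not_forall, not_subsingleton_iff_nontrivial]

theorem shortExact_mk (i : X ⟶ Y) (p : Y ⟶ Z) (w : i ≫ p = 0)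
    (hi : ∀ v, Function.Injective (lin i v)) (hp : ∀ v, Function.Surjective (lin p v))
    (hip : ∀ v y, lin p v y = 0 → ∃ x, lin i v x = y) :
    (ShortComplex.mk i p w).ShortExact := by
  have := mono_of_injective i hi
  have := epi_of_surjective p hp
  refine { exact := ?_ }
  rw [ShortComplex.exact_iff_exact_up_to_refinements]
  intro A y hy
  have hlift (v a) : ∃ x, lin i v x = lin y v a := hip v _ (congrArg (fun g => lin g v a) hy)
  choose g hg using hlift
  refine ⟨A, 𝟙 A, inferInstance, homMk (fun v =>
    { toFun := g v
      map_add' := fun a b => hi v (by simp [hg])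
      map_smul' := fun c a => hi v (by simp [hg]) }) (fun α a => hi _ ?_), ?_⟩
  · simp [hg, lin_act]
  · exact hom_ext fun v a => by simp [hg]

theorem shortExact_lin {i : X ⟶ Y} {p : Y ⟶ Z} {w : i ≫ p = 0}
    (h : (ShortComplex.mk i p w).ShortExact) (v : V) :
    Function.Injective (lin i v) ∧ Function.Exact (lin i v) (lin p v) ∧
      Function.Surjective (lin p v) := by
  let ev := (evaluation (Paths V) (FGModuleCat.{u} k)).obj ((Paths.of V).obj v)
  have : ev.Additive := inferInstance
  have h' := (h.map_of_exact ev).map_of_exact (forget₂ (FGModuleCat.{u} k) (ModuleCat.{u} k))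
  exact ⟨h'.moduleCat_injective_f,
    (ShortComplex.ShortExact.moduleCat_exact_iff_function_exact _).1 h'.exact,
    h'.moduleCat_surjective_g⟩

theorem finrank_of_shortExact {i : X ⟶ Y} {p : Y ⟶ Z} {w : i ≫ p = 0}
    (h : (ShortComplex.mk i p w).ShortExact) (v : V) :
    Module.finrank k (space Y v) =
      Module.finrank k (space X v) + Module.finrank k (space Z v) := by
  obtain ⟨hi, hip, hp⟩ := shortExact_lin h v
  rw [← LinearMap.finrank_range_of_inj hi, ← LinearMap.exact_iff.1 hip,
    ← LinearMap.finrank_range_add_finrank_ker (lin p v), LinearMap.range_eq_top.2 hp, finrank_top,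
    add_comm]

theorem finrank_biprod (v : V) : Module.finrank k (space (X ⊞ Y) v) =
    Module.finrank k (space X v) + Module.finrank k (space Y v) :=
  finrank_of_shortExact (ShortComplex.Splitting.ofHasBinaryBiproduct X Y).shortExact v

/-- The isomorphism at a vertex induced by an isomorphism of representations. -/
def spaceEquiv (e : X ≅ Y) (v : V) : space X v ≃ₗ[k] space Y v :=
  LinearEquiv.ofLinearMap (lin e.hom v) (lin e.inv v)
    (by ext x; simp [← lin_comp]) (by ext x; simp [← lin_comp])

theorem comp_eq_zero_of_subsingleton_space (hX : IsBrick k X) (v : V) [Nontrivial (space X v)]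
    [Subsingleton (space Y v)] (f : X ⟶ Y) (g : Y ⟶ X) : f ≫ g = 0 := by
  obtain ⟨c, hc⟩ := hX.2 (f ≫ g)
  obtain ⟨x, hx⟩ := exists_ne (0 : space X v)
  have : c • x = 0 := by
    rw [← lin_id v x, ← lin_smul, ← hc, lin_comp, Subsingleton.elim (lin f v x) 0, map_zero]
  rw [hc, (smul_eq_zero.1 this).resolve_right hx, zero_smul]

end Basic

/-! ### Thin representations -/

section Thin

/-- The subspace of `k` that is everything if `p` holds and zero otherwise. -/
def thinSpace (k : Type u) [Field k] (p : Prop) : Submodule k k where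
  carrier := {x | ¬ p → x = 0}
  add_mem' ha hb h := by rw [ha h, hb h, add_zero]
  zero_mem' _ := rfl
  smul_mem' c x hx h := by rw [hx h, smul_zero]

open scoped Classical in
/-- The retraction of `k` onto `thinSpace k p`. -/
noncomputable def toThinSpace (k : Type u) [Field k] (p : Prop) : k →ₗ[k] thinSpace k p where
  toFun c := ⟨if p then c else 0, fun h => if_neg h⟩
  map_add' x y := by ext; by_cases p <;> simp [*]
  map_smul' c x := by ext; by_cases p <;> simp [*]

variable {k : Type u} [Field k] {V : Type} [Quiver.{0} V]

variable (k) in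
/-- The thin representation supported on the vertices with `P`: one-dimensional there, with
identity maps. -/
noncomputable def thin (P : V → Prop) : QuiverRep k V :=
  of (fun v => thinSpace k (P v))
    (fun {s t} _ => toThinSpace k (P t) ∘ₗ (thinSpace k (P s)).subtype)

variable {P Q : V → Prop} {X : QuiverRep k V}

/-- The coordinate on the space of a thin representation. -/
def coord (P : V → Prop) (v : V) : space (thin k P) v →ₗ[k] k := (thinSpace k (P v)).subtype

/-- The vector with a given coordinate in the space of a thin representation, which is zero outside
of the support. -/
noncomputable def pt (P : V → Prop) (v : V) : k →ₗ[k] space (thin k P) v := toThinSpace k (P v)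

theorem act_thin {s t : V} (α : s ⟶ t) (x : space (thin k P) s) :
    act (thin k P) α x = pt P t (coord P s x) :=
  act_of (fun v => thinSpace k (P v))
    (fun {s t} _ => toThinSpace k (P t) ∘ₗ (thinSpace k (P s)).subtype) α x

theorem coord_eq_zero {v : V} (h : ¬ P v) (x : space (thin k P) v) : coord P v x = 0 :=
  Subtype.property (p := (· ∈ thinSpace k (P v))) x h

theorem thin_ext {v : V} {x y : space (thin k P) v} (h : P v → coord P v x = coord P v y) :
    x = y := by
  refine Subtype.val_injective (p := (· ∈ thinSpace k (P v))) ?_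
  by_cases hv : P v
  · exact h hv
  · exact (coord_eq_zero hv x).trans (coord_eq_zero hv y).symm

theorem subsingleton_space_thin {v : V} (h : ¬ P v) : Subsingleton (space (thin k P) v) :=
  ⟨fun _ _ => thin_ext fun hv => absurd hv h⟩

theorem thin_eq_zero {v : V} (h : ¬ P v) (x : space (thin k P) v) : x = 0 :=
  thin_ext fun hv => absurd hv h

theorem coord_pt {v : V} (h : P v) (c : k) : coord P v (pt P v c) = c := if_pos h

@[simp] theorem pt_coord (v : V) (x : space (thin k P) v) : pt P v (coord P v x) = x :=
  thin_ext fun h => coord_pt h _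

theorem coord_act {s t : V} (α : s ⟶ t) (h : P t) (x : space (thin k P) s) :
    coord P t (act (thin k P) α x) = coord P s x := by
  rw [act_thin, coord_pt h]

theorem act_pt {s t : V} (α : s ⟶ t) (h : P s) (c : k) :
    act (thin k P) α (pt P s c) = pt P t c := by
  rw [act_thin, coord_pt h]

/-- The coordinate as an isomorphism, on the support. -/
noncomputable def coordEquiv {v : V} (h : P v) : space (thin k P) v ≃ₗ[k] k :=
  LinearEquiv.ofLinearMap (coord P v) (pt P v) (LinearMap.ext (coord_pt h))
    (LinearMap.ext (pt_coord v))

theorem nontrivial_space_thin {v : V} (h : P v) : Nontrivial (space (thin k P) v) :=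
  (coordEquiv (k := k) h).toEquiv.nontrivial

theorem finrank_thin {v : V} (h : P v) : Module.finrank k (space (thin k P) v) = 1 :=
  (coordEquiv h).finrank_eq.trans (Module.finrank_self k)

theorem finrank_thin_le (v : V) : Module.finrank k (space (thin k P) v) ≤ 1 := by
  by_cases h : P v
  · exact (finrank_thin h).le
  · have := subsingleton_space_thin (k := k) h
    exact Module.finrank_zero_of_subsingleton.trans_le zero_le_one

/-- The morphism from a thin representation given by a compatible family of vectors. -/
noncomputable def fromThin (x : ∀ v, space X v) (hx : ∀ v, ¬ P v → x v = 0)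
    (h : ∀ {s t : V} (α : s ⟶ t), P s → act X α (x s) = x t) : thin k P ⟶ X :=
  homMk (fun v => (coord P v).smulRight (x v)) fun {s t} α c => by
    by_cases hs : P s
    · by_cases ht : P t
      · simp [coord_act α ht, h α hs]
      · simp [h α hs, hx t ht]
    · simp [thin_eq_zero hs c]

theorem lin_fromThin (x : ∀ v, space X v) (hx : ∀ v, ¬ P v → x v = 0)
    (h : ∀ {s t : V} (α : s ⟶ t), P s → act X α (x s) = x t) (v : V) (c : space (thin k P) v) :
    lin (fromThin x hx h) v c = coord P v c • x v := rfl

/-- The morphism to a thin representation given by a compatible family of linear forms. -/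
noncomputable def toThin (φ : ∀ v, space X v →ₗ[k] k) (hφ : ∀ v, ¬ P v → φ v = 0)
    (h : ∀ {s t : V} (α : s ⟶ t), P t → ∀ x, φ t (act X α x) = φ s x) : X ⟶ thin k P :=
  homMk (fun v => pt P v ∘ₗ φ v) fun {s t} α x => thin_ext fun ht => by
    by_cases hs : P s
    · simp [coord_act α ht, coord_pt ht, coord_pt hs, h α ht]
    · simp [h α ht, hφ s hs]

theorem lin_toThin (φ : ∀ v, space X v →ₗ[k] k) (hφ : ∀ v, ¬ P v → φ v = 0)
    (h : ∀ {s t : V} (α : s ⟶ t), P t → ∀ x, φ t (act X α x) = φ s x) (v : V) (x : space X v) :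
    lin (toThin φ hφ h) v x = pt P v (φ v x) := rfl

/-- A set of vertices that is nonempty and connected by the arrows between its elements. -/
def IsConnectedSupport (P : V → Prop) : Prop :=
  (∃ v, P v) ∧
    ∀ v w, P v → P w → Relation.EqvGen (fun s t => P s ∧ P t ∧ Nonempty (s ⟶ t)) v w

theorem IsConnectedSupport.eq_of_forall_arrow {γ : Type*} (hP : IsConnectedSupport P) {c : V → γ}
    (hc : ∀ {s t : V} (_ : s ⟶ t), P s → P t → c s = c t) {v w : V} (hv : P v) (hw : P w) :
    c v = c w := by
  have hvw := hP.2 v w hv hw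
  clear hv hw
  induction hvw with
  | rel s t h => exact hc h.2.2.some h.1 h.2.1
  | refl => rfl
  | symm s t _ ih => exact ih.symm
  | trans s t r _ _ ih₁ ih₂ => exact ih₁.trans ih₂

theorem isBrick_thin (hP : IsConnectedSupport P) : IsBrick k (thin k P) := by
  obtain ⟨v₀, h₀⟩ := hP.1
  refine ⟨not_isZero_iff.2 ⟨v₀, nontrivial_space_thin h₀⟩,
    fun f => ⟨coord P v₀ (lin f v₀ (pt P v₀ 1)), hom_ext fun v x => thin_ext fun hv => ?_⟩⟩
  have hconst : coord P v₀ (lin f v₀ (pt P v₀ 1)) = coord P v (lin f v (pt P v 1)) :=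
    hP.eq_of_forall_arrow (c := fun v => coord P v (lin f v (pt P v 1))) (fun α hs ht => by
      rw [← coord_act α ht, ← lin_act, act_pt α hs]) h₀ hv
  have hx : x = coord P v x • pt P v 1 := by rw [← map_smul, smul_eq_mul, mul_one, pt_coord]
  rw [hconst, lin_smul, lin_id, map_smul, smul_eq_mul, mul_comm, ← smul_eq_mul, ← map_smul,
    ← map_smul, ← hx]

theorem thin_comp_eq_zero (hP : IsConnectedSupport P) (hQ : IsConnectedSupport Q) {v : V}
    (hv : ¬ (P v ↔ Q v)) (f : thin k P ⟶ thin k Q) (g : thin k Q ⟶ thin k P) : f ≫ g = 0 := by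
  by_cases hPv : P v
  · have := nontrivial_space_thin (k := k) hPv
    have := subsingleton_space_thin (k := k) (P := Q) (v := v) (by tauto)
    exact comp_eq_zero_of_subsingleton_space (isBrick_thin hP) v f g
  · have := subsingleton_space_thin (k := k) hPv
    have := nontrivial_space_thin (k := k) (P := Q) (v := v) (by tauto)
    exact (isBrick_thin hP).comp_eq_zero_of_comp_eq_zero
      (comp_eq_zero_of_subsingleton_space (isBrick_thin hQ) v g f)

end Thin

end QuiverRep

/-! ### Direct summands and almost rigidity -/

namespace QuiverRep

section Summands

variable {k : Type u} [Field k] {V : Type} [Quiver.{0} V] {X A B T T' : QuiverRep k V}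

theorem isSummand_iff : IsSummand A T ↔ ∃ (a : A ⟶ T) (p : T ⟶ A), a ≫ p = 𝟙 A := by
  constructor
  · rintro ⟨B, ⟨e⟩⟩
    exact ⟨biprod.inl ≫ e.inv, e.hom ≫ biprod.fst, by simp⟩
  · rintro ⟨a, p, h⟩
    have : IsSplitEpi p := ⟨⟨a, h⟩⟩
    have split := ShortComplex.Splitting.ofExactOfSection
      (ShortComplex.mk (kernel.ι p) p (kernel.condition p)) (ShortComplex.exact_kernel p) a h
      inferInstance
    exact ⟨_, ⟨split.isoBinaryBiproduct ≪≫ biprod.braiding _ _⟩⟩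

theorem IsSummand.trans (h : IsSummand A B) (h' : IsSummand B T) : IsSummand A T := by
  rw [isSummand_iff] at *
  obtain ⟨a, p, h⟩ := h
  obtain ⟨a', p', h'⟩ := h'
  exact ⟨a ≫ a', p' ≫ p, by rw [Category.assoc, reassoc_of% h', h]⟩

theorem isSummand_of_iso (e : A ≅ T) : IsSummand A T :=
  isSummand_iff.2 ⟨e.hom, e.inv, e.hom_inv_id⟩

theorem isSummand_congr (e : T ≅ T') : IsSummand A T ↔ IsSummand A T' :=
  ⟨fun h => h.trans (isSummand_of_iso e), fun h => h.trans (isSummand_of_iso e.symm)⟩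

theorem isSummand_inl : IsSummand A (A ⊞ B) := ⟨B, ⟨Iso.refl _⟩⟩

theorem isSummand_inr : IsSummand B (A ⊞ B) := ⟨A, ⟨biprod.braiding _ _⟩⟩

theorem IsSummand.biprod (h : IsSummand A T) (h' : IsSummand B T') :
    IsSummand (A ⊞ B) (T ⊞ T') := by
  rw [isSummand_iff] at *
  obtain ⟨a, p, h⟩ := h
  obtain ⟨a', p', h'⟩ := h'
  exact ⟨biprod.map a a', biprod.map p p', by
    apply biprod.hom_ext' <;> apply biprod.hom_ext <;> simp [reassoc_of% h, reassoc_of% h']⟩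

theorem isSummand_biprod_self_biproduct {J : Type} [Finite J] {N : J → QuiverRep k V} {a b : J}
    (hab : a ≠ b) (h : N a = N b) : IsSummand (N a ⊞ N a) (⨁ N) := by
  have hsplit : IsSummand (N a ⊞ N b) (⨁ N) := by
    refine isSummand_iff.2 ⟨biprod.desc (biproduct.ι N a) (biproduct.ι N b),
      biprod.lift (biproduct.π N a) (biproduct.π N b), ?_⟩
    apply biprod.hom_ext' <;> apply biprod.hom_ext <;>
      simp [biproduct.ι_π_ne _ hab, biproduct.ι_π_ne _ hab.symm]
  exact (isSummand_of_iso (biprod.mapIso (Iso.refl _) (eqToIso h))).trans hsplit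

/-- A family of bricks without nonzero compositions `M i ⟶ M j ⟶ M i` for `i ≠ j`, one of which is
a summand of every nonzero representation. -/
structure IsBrickSystem {I : Type} (M : I → QuiverRep k V) : Prop where
  isBrick : ∀ i, IsBrick k (M i)
  comp_eq_zero : ∀ {i j}, i ≠ j → ∀ (f : M i ⟶ M j) (g : M j ⟶ M i), f ≫ g = 0
  exists_isSummand : ∀ X : QuiverRep k V, ¬ IsZero X → ∃ i, IsSummand (M i) X

namespace IsBrickSystem

variable {I : Type} {M : I → QuiverRep k V} (hM : IsBrickSystem M)
include hM

theorem indecomposable (i : I) : Indecomposable (M i) := (hM.isBrick i).indecomposable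

theorem exists_iso (hX : Indecomposable X) : ∃ i, Nonempty (X ≅ M i) := by
  obtain ⟨i, B, ⟨e⟩⟩ := hM.exists_isSummand X hX.1
  have hB := (hX.2 _ _ e).resolve_left (hM.isBrick i).not_isZero
  have hinl : biprod.fst ≫ biprod.inl = 𝟙 (M i ⊞ B) :=
    biprod.hom_ext _ _ (by simp) (hB.eq_of_tgt _ _)
  exact ⟨i, ⟨e ≪≫ ⟨biprod.fst, biprod.inl, hinl, biprod.inl_fst⟩⟩⟩

theorem exists_decomposition [Finite V] (T : QuiverRep k V) :
    ∃ (J : Type) (_ : Finite J) (σ : J → I), Nonempty (T ≅ ⨁ fun j => M (σ j)) := by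
  have := Fintype.ofFinite V
  induction h : ∑ v, Module.finrank k (space T v) using Nat.strong_induction_on generalizing T with
  | _ d ih =>
    by_cases hT : IsZero T
    · refine ⟨Empty, inferInstance, Empty.elim, ⟨hT.iso ?_⟩⟩
      rw [IsZero.iff_id_eq_zero]
      exact biproduct.hom_ext _ _ (fun j => j.elim)
    · obtain ⟨i, B, ⟨e⟩⟩ := hM.exists_isSummand T hT
      have hfinrank (v : V) : Module.finrank k (space T v) =
          Module.finrank k (space (M i) v) + Module.finrank k (space B v) :=
        (spaceEquiv e v).finrank_eq.trans (finrank_biprod v)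
      obtain ⟨v, hv⟩ := not_isZero_iff.1 (hM.isBrick i).not_isZero
      have hlt : ∑ v, Module.finrank k (space B v) < d := by
        rw [← h]
        refine Finset.sum_lt_sum (fun v _ => by rw [hfinrank]; lia) ⟨v, Finset.mem_univ v, ?_⟩
        rw [hfinrank]
        exact Nat.lt_add_of_pos_left Module.finrank_pos
      obtain ⟨J, hJ, σ, ⟨e'⟩⟩ := ih _ hlt B rfl
      exact ⟨Option J, inferInstance, fun o => o.elim i σ,
        ⟨e ≪≫ biprod.mapIso (Iso.refl _) e' ≪≫
          biproductOptionIso (fun o : Option J => M (o.elim i σ))⟩⟩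

variable {J : Type} [Finite J] {σ : J → I}

theorem isSummand_biproduct_iff (i : I) :
    IsSummand (M i) (⨁ fun j => M (σ j)) ↔ i ∈ Set.range σ := by
  have := Fintype.ofFinite J
  constructor
  · rw [isSummand_iff]
    rintro ⟨a, p, h⟩
    by_contra hi
    refine (hM.isBrick i).id_ne_zero ?_
    rw [← h, comp_eq_sum_biproduct]
    exact Finset.sum_eq_zero fun j _ => hM.comp_eq_zero (fun hj => hi ⟨j, hj.symm⟩) _ _
  · rintro ⟨j, rfl⟩
    exact isSummand_iff.2 ⟨biproduct.ι (fun j => M (σ j)) j, biproduct.π _ j,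
      biproduct.ι_π_self _ _⟩

theorem isSummand_iff_mem_range (e : T ≅ ⨁ fun j => M (σ j)) (i : I) :
    IsSummand (M i) T ↔ i ∈ Set.range σ :=
  (isSummand_congr e).trans (hM.isSummand_biproduct_iff i)

theorem comp_eq_comp_of_injective (hσ : Function.Injective σ) (j : J)
    (f : M (σ j) ⟶ ⨁ fun j => M (σ j)) (g : (⨁ fun j => M (σ j)) ⟶ M (σ j)) :
    f ≫ g = (f ≫ biproduct.π _ j) ≫ biproduct.ι (fun j => M (σ j)) j ≫ g := by
  have := Fintype.ofFinite J
  rw [comp_eq_sum_biproduct, Finset.sum_eq_single j]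
  · exact fun j' _ hj => hM.comp_eq_zero (hσ.ne hj.symm) _ _
  · simp

theorem not_isSummand_biprod_self (hσ : Function.Injective σ) (i : I) :
    ¬ IsSummand (M i ⊞ M i) (⨁ fun j => M (σ j)) := by
  intro h
  obtain ⟨j, rfl⟩ := (hM.isSummand_biproduct_iff i).1 (isSummand_inl.trans h)
  obtain ⟨a, p, h⟩ := isSummand_iff.1 h
  have h11 : (biprod.inl ≫ a) ≫ p ≫ biprod.fst = 𝟙 (M (σ j)) := by simp [reassoc_of% h]
  have h22 : (biprod.inr ≫ a) ≫ p ≫ biprod.snd = 𝟙 (M (σ j)) := by simp [reassoc_of% h]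
  have h12 : (biprod.inl ≫ a) ≫ p ≫ biprod.snd = 0 := by simp [reassoc_of% h]
  rw [hM.comp_eq_comp_of_injective hσ] at h11 h12 h22
  have hne := (hM.isBrick (σ j)).id_ne_zero
  rcases (hM.isBrick (σ j)).comp_eq_zero_iff.1 h12 with h0 | h0
  · exact hne (by rw [← h11, h0, zero_comp])
  · exact hne (by rw [← h22, h0, comp_zero])

theorem isBasic_iff_injective (e : T ≅ ⨁ fun j => M (σ j)) :
    IsBasic T ↔ Function.Injective σ := by
  constructor
  · intro h a b hab
    by_contra hne
    exact h _ (hM.indecomposable (σ a)) ((isSummand_congr e).2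
      (isSummand_biprod_self_biproduct hne (congrArg M hab)))
  · intro hσ A hA hs
    obtain ⟨i, ⟨f⟩⟩ := hM.exists_iso hA
    exact hM.not_isSummand_biprod_self hσ i
      ((isSummand_of_iso (biprod.mapIso f.symm f.symm)).trans ((isSummand_congr e).1 hs))

end IsBrickSystem

end Summands

section AlmostRigid

variable {k : Type u} [Field k] {V : Type} [Quiver.{0} V] {A A' B B' E T : QuiverRep k V}

theorem ExtGeneratedByIndecomposable.of_iso (h : ExtGeneratedByIndecomposable A B) (e : A ≅ A')
    (f : B ≅ B') : ExtGeneratedByIndecomposable A' B' := by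
  obtain ⟨hrank, E, i, p, w, hS, hE, hspan⟩ := h
  let Φ := extLinearEquivOfIso k e f 1
  have w' : (f.inv ≫ i) ≫ p ≫ e.hom = 0 := by simp [reassoc_of% w]
  have hS' : (ShortComplex.mk (f.inv ≫ i) (p ≫ e.hom) w').ShortExact :=
    ShortComplex.shortExact_of_iso
      (ShortComplex.isoMk f (Iso.refl E) e (by simp) (by simp)) hS
  have hΦ : Φ hS.extClass = hS'.extClass := by
    have := ShortComplex.ShortExact.extClass_naturality hS hS'
      { τ₁ := f.hom, τ₂ := 𝟙 E, τ₃ := e.hom }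
    change (Ext.mk₀ e.inv).comp (hS.extClass.comp (Ext.mk₀ f.hom) (add_zero 1)) (zero_add 1) = _
    rw [this]
    simp
  refine ⟨Φ.finrank_eq.symm.trans hrank, E, _, _, w', hS', hE, ?_⟩
  rw [← hΦ, ← Set.image_singleton, ← LinearEquiv.coe_coe, Submodule.span_image, hspan,
    Submodule.map_top, LinearEquiv.range]

theorem extGeneratedByIndecomposable_of_shortExact {i : B ⟶ E} {p : E ⟶ A} {w : i ≫ p = 0}
    (hS : (ShortComplex.mk i p w).ShortExact) (hA : IsBrick k A) (hE : Indecomposable E)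
    [Subsingleton (Ext.{u + 1} A E 1)] (hs : ¬ ∃ s : A ⟶ E, s ≫ p = 𝟙 A) :
    ExtGeneratedByIndecomposable A B := by
  have hne : (hS.extClass : Ext.{u + 1} A B 1) ≠ 0 :=
    fun h => hs ((extClass_eq_zero_iff_exists_section hS).1 h)
  have hspan (x : Ext.{u + 1} A B 1) : ∃ c : k, c • (hS.extClass : Ext.{u + 1} A B 1) = x := by
    obtain ⟨y, rfl⟩ := Ext.covariant_sequence_exact₁ A hS x (Subsingleton.elim _ _) (n₀ := 0) rfl
    obtain ⟨f, rfl⟩ := (Ext.mk₀_bijective _ _).2 y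
    obtain ⟨c, rfl⟩ := hA.2 f
    exact ⟨c, by simp [Ext.mk₀_smul]⟩
  exact ⟨finrank_eq_one _ hne hspan, E, i, p, w, hS, hE,
    (Submodule.eq_top_iff' (p := Submodule.span k _)).2 fun x =>
      Submodule.mem_span_singleton.2 (hspan x)⟩

/-- The condition on `Ext(A, B)` that almost rigidity imposes on pairs of summands. -/
def IsExtAdmissible (A B : QuiverRep k V) : Prop :=
  Subsingleton (Ext.{u + 1} A B 1) ∨ ExtGeneratedByIndecomposable A B

theorem IsExtAdmissible.of_iso (h : IsExtAdmissible A B) (e : A ≅ A') (f : B ≅ B') :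
    IsExtAdmissible A' B' :=
  h.imp (fun (_ : Subsingleton (Ext.{u + 1} A B 1)) =>
    (extLinearEquivOfIso.{u + 1} k e f 1).symm.toEquiv.subsingleton) (·.of_iso e f)

/-- A set of members of a family `M` whose pairwise `Ext` groups, in both orders, satisfy the
condition of almost rigidity. -/
def IsExtClique {I : Type} (M : I → QuiverRep k V) (S : Set I) : Prop :=
  ∀ i ∈ S, ∀ j ∈ S, IsExtAdmissible (M i) (M j)

namespace IsBrickSystem

variable {I : Type} {M : I → QuiverRep k V} (hM : IsBrickSystem M)
include hM

theorem isAlmostRigid_iff :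
    IsAlmostRigid T ↔ IsBasic T ∧ IsExtClique M {i | IsSummand (M i) T} := by
  refine and_congr_right fun _ => ⟨fun h i hi j hj => ?_, fun h A B hA hB hAT hBT => ?_⟩
  · exact h _ _ (hM.indecomposable i) (hM.indecomposable j) hi hj
  · obtain ⟨i, ⟨e⟩⟩ := hM.exists_iso hA
    obtain ⟨j, ⟨f⟩⟩ := hM.exists_iso hB
    exact (h i ((isSummand_of_iso e.symm).trans hAT) j
      ((isSummand_of_iso f.symm).trans hBT)).of_iso e.symm f.symm

variable {J : Type} [Finite J] {σ : J → I}

theorem isAlmostRigid_iff_of_iso (e : T ≅ ⨁ fun j => M (σ j)) :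
    IsAlmostRigid T ↔ Function.Injective σ ∧ IsExtClique M (Set.range σ) := by
  have hrange : {i | IsSummand (M i) T} = Set.range σ := Set.ext (hM.isSummand_iff_mem_range e)
  rw [hM.isAlmostRigid_iff, hM.isBasic_iff_injective e, hrange]

theorem isMaximalAlmostRigid_iff (e : T ≅ ⨁ fun j => M (σ j)) :
    IsMaximalAlmostRigid T ↔
      Function.Injective σ ∧ Maximal (IsExtClique M) (Set.range σ) := by
  constructor
  · rintro ⟨h, hmax⟩
    obtain ⟨hσ, hc⟩ := (hM.isAlmostRigid_iff_of_iso e).1 h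
    refine ⟨hσ, hc, fun S hS hσS i hi => ?_⟩
    by_contra hn
    let τ : Option J → I := fun o => o.elim i σ
    have hτ : Set.range τ ⊆ S := by
      rintro _ ⟨_ | a, rfl⟩
      exacts [hi, hσS ⟨a, rfl⟩]
    have eτ : T ⊞ M i ≅ ⨁ fun o => M (τ o) := biprod.braiding _ _ ≪≫
      biprod.mapIso (Iso.refl _) e ≪≫ biproductOptionIso fun o => M (τ o)
    refine hmax (M i) (hM.isBrick i).not_isZero ((hM.isAlmostRigid_iff_of_iso eτ).2
      ⟨?_, fun a ha b hb => hS a (hτ ha) b (hτ hb)⟩)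
    rintro (_ | a) (_ | b) hab
    · rfl
    · exact absurd ⟨b, hab.symm⟩ hn
    · exact absurd ⟨a, hab⟩ hn
    · exact congrArg some (hσ hab)
  · rintro ⟨hσ, hmax⟩
    refine ⟨(hM.isAlmostRigid_iff_of_iso e).2 ⟨hσ, hmax.prop⟩, fun N hN hT => ?_⟩
    obtain ⟨i, hi⟩ := hM.exists_isSummand N hN
    obtain ⟨hbasic, hclique⟩ := hM.isAlmostRigid_iff.1 hT
    have hsub : Set.range σ ⊆ {i | IsSummand (M i) (T ⊞ N)} := fun j hj =>
      ((hM.isSummand_iff_mem_range e j).2 hj).trans isSummand_inl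
    have hiσ := hmax.le_of_ge hclique hsub (hi.trans isSummand_inr)
    exact hbasic _ (hM.indecomposable i) (((hM.isSummand_iff_mem_range e i).2 hiσ).biprod hi)

theorem exists_isSumOfIndecomposables_iff [Finite V] (hT : IsMaximalAlmostRigid T) :
    ∃ S, Maximal (IsExtClique M) S ∧ ∀ m, IsSumOfIndecomposables T m ↔ m = S.ncard := by
  obtain ⟨J, hJ, σ, ⟨e⟩⟩ := hM.exists_decomposition T
  obtain ⟨hσ, hmax⟩ := (hM.isMaximalAlmostRigid_iff e).1 hT
  refine ⟨_, hmax, fun m => ⟨?_, ?_⟩⟩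
  · rintro ⟨N, hN, ⟨f⟩⟩
    choose τ hτ using fun i => hM.exists_iso (hN i)
    have f' : T ≅ ⨁ fun j => M (τ j) := f ≪≫ biproduct.mapIso fun i => (hτ i).some
    have hτ := ((hM.isMaximalAlmostRigid_iff f').1 hT).1
    have hrange : Set.range σ = Set.range τ := Set.ext fun i =>
      (hM.isSummand_iff_mem_range e i).symm.trans (hM.isSummand_iff_mem_range f' i)
    rw [hrange, Set.ncard_range_of_injective hτ, Nat.card_fin]
  · rw [Set.ncard_range_of_injective hσ]
    rintro rfl
    exact ⟨fun i => M (σ ((Finite.equivFin J).symm i)), fun i => hM.indecomposable _,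
      ⟨e ≪≫ biproduct.whiskerEquiv (Finite.equivFin J) fun j => eqToIso (by simp)⟩⟩

theorem isMaximalAlmostRigid_biproduct [Finite I] {S : Set I} (hS : Maximal (IsExtClique M) S) :
    IsMaximalAlmostRigid (⨁ fun j : S => M j) :=
  (hM.isMaximalAlmostRigid_iff (σ := fun j : S => j.1) (Iso.refl _)).2
    ⟨Subtype.val_injective, by rwa [Subtype.range_coe]⟩

theorem card_mar [Finite V] [Finite I] :
    Nat.card (mar k V) = {S | Maximal (IsExtClique M) S}.ncard := by
  refine (Nat.card_congr (Equiv.ofBijective (fun S : {S | Maximal (IsExtClique M) S} =>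
    (⟨_, _, hM.isMaximalAlmostRigid_biproduct S.2, rfl⟩ : mar k V)) ⟨fun S S' h => ?_, ?_⟩)).symm
  · obtain ⟨e⟩ : Nonempty ((⨁ fun j : S.1 => M j.1) ≅ ⨁ fun j : S'.1 => M j.1) :=
      Quotient.exact (congrArg Subtype.val h)
    refine Subtype.ext (Set.ext fun i => ?_)
    have hi := (hM.isSummand_biproduct_iff (σ := fun j : S.1 => j.1) i).symm.trans
      (hM.isSummand_iff_mem_range (σ := fun j : S'.1 => j.1) e i)
    rwa [Subtype.range_coe, Subtype.range_coe] at hi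
  · rintro ⟨_, T, hT, rfl⟩
    obtain ⟨J, hJ, σ, ⟨e⟩⟩ := hM.exists_decomposition T
    obtain ⟨hσ, hmax⟩ := (hM.isMaximalAlmostRigid_iff e).1 hT
    refine ⟨⟨_, hmax⟩, Subtype.ext (Quotient.sound ⟨?_⟩)⟩
    exact (e ≪≫ biproduct.whiskerEquiv (f := fun j => M (σ j)) (g := fun j => M j.1)
      (Equiv.ofInjective σ hσ) fun j => Iso.refl _).symm

end IsBrickSystem

end AlmostRigid

end QuiverRep

/-! ### Extensions of thin representations -/

namespace QuiverRep

section ThinExt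

variable {k : Type u} [Field k] {V : Type} [Quiver.{0} V] {P Q : V → Prop} {E : QuiverRep k V}

variable (k) in
/-- The surjectivity of the coboundary map from the functions on `P ∩ Q` to the functions on the
arrows from `P` to `Q`. Its cokernel is `Ext¹(thin P, thin Q)`. -/
def CoboundarySurjective (P Q : V → Prop) : Prop :=
  ∀ c : ∀ s t : V, (s ⟶ t) → k, ∃ h : V → k, (∀ v, ¬ (P v ∧ Q v) → h v = 0) ∧
    ∀ (s t : V) (α : s ⟶ t), P s → Q t → h t - h s = c s t α

theorem act_pt_of_eq_zero {s t : V} (α : s ⟶ t) {c : k} (h : ¬ P s → c = 0) :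
    act (thin k P) α (pt P s c) = pt P t c := by
  by_cases hs : P s
  · exact act_pt α hs c
  · simp [h hs]

theorem exists_lift_pt_one {p : E ⟶ thin k P} (hp : ∀ v, Function.Surjective (lin p v)) :
    ∃ x : ∀ v, space E v, ∀ v, lin p v (x v) = pt P v 1 ∧ (¬ P v → x v = 0) := by
  have hx (v : V) : ∃ x : space E v, lin p v x = pt P v 1 ∧ (¬ P v → x = 0) := by
    by_cases hv : P v
    · obtain ⟨x, hx⟩ := hp v (pt P v 1)
      exact ⟨x, hx, fun h => absurd hv h⟩
    · exact ⟨0, thin_ext fun h => absurd h hv, fun _ => rfl⟩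
  choose x hx using hx
  exact ⟨x, hx⟩

theorem exists_act_eq_add {i : thin k Q ⟶ E} {p : E ⟶ thin k P}
    (hip : ∀ v, Function.Exact (lin i v) (lin p v)) {x : ∀ v, space E v}
    (hx : ∀ v, lin p v (x v) = pt P v 1) :
    ∃ c : ∀ s t : V, (s ⟶ t) → k, ∀ (s t : V) (α : s ⟶ t), P s →
      act E α (x s) = x t + lin i t (pt Q t (c s t α)) := by
  have hc (s t : V) (α : s ⟶ t) : ∃ c : k, P s → act E α (x s) = x t + lin i t (pt Q t c) := by
    by_cases hs : P s
    · obtain ⟨d, hd⟩ := (hip t (act E α (x s) - x t)).1 (by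
        rw [map_sub, lin_act, hx, hx, act_pt α hs, sub_self])
      exact ⟨coord Q t d, fun _ => by rw [pt_coord, hd, add_sub_cancel]⟩
    · exact ⟨0, fun h => absurd h hs⟩
  choose c hc using hc
  exact ⟨c, hc⟩

theorem CoboundarySurjective.exists_section (h : CoboundarySurjective k P Q) {i : thin k Q ⟶ E}
    {p : E ⟶ thin k P} {w : i ≫ p = 0} (hS : (ShortComplex.mk i p w).ShortExact) :
    ∃ s : thin k P ⟶ E, s ≫ p = 𝟙 _ := by
  have hE := shortExact_lin hS
  obtain ⟨x, hx⟩ := exists_lift_pt_one fun v => (hE v).2.2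
  obtain ⟨c, hc⟩ := exists_act_eq_add (fun v => (hE v).2.1) fun v => (hx v).1
  obtain ⟨g, hg₀, hg⟩ := h c
  refine ⟨fromThin (fun v => x v + lin i v (pt Q v (g v))) (fun v hv => ?_) (fun {s t} α hs => ?_),
    hom_ext fun v y => ?_⟩
  · simp [(hx v).2 hv, hg₀ v fun h => hv h.1]
  · have hpt : pt Q t (c s t α) + pt Q t (g s) = pt Q t (g t) := by
      rw [← map_add]
      exact thin_ext fun ht => by rw [← hg s t α hs ht, sub_add_cancel]
    rw [map_add, ← lin_act, act_pt_of_eq_zero α fun hq => hg₀ s fun h => hq h.2, hc s t α hs,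
      add_assoc, ← map_add, hpt]
  · have hpi : lin p v (lin i v (pt Q v (g v))) = 0 := ((hE v).2.1 _).2 ⟨_, rfl⟩
    rw [lin_comp, lin_fromThin, map_smul, map_add, (hx v).1, hpi, add_zero, ← map_smul,
      smul_eq_mul, mul_one, pt_coord, lin_id]

/-- The extension of `thin k P` by `thin k Q` with off-diagonal matrix entries `c`. -/
noncomputable def thinExtension (P Q : V → Prop) (c : ∀ s t : V, (s ⟶ t) → k) : QuiverRep k V :=
  of (fun v => space (thin k Q) v × space (thin k P) v) fun {s t} α =>
    (act (thin k Q) α ∘ₗ LinearMap.fst k _ _ +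
      c s t α • pt Q t ∘ₗ coord P s ∘ₗ LinearMap.snd k _ _).prod
        (act (thin k P) α ∘ₗ LinearMap.snd k _ _)

theorem act_thinExtension (c : ∀ s t : V, (s ⟶ t) → k) {s t : V} (α : s ⟶ t)
    (x : space (thin k Q) s × space (thin k P) s) :
    act (thinExtension P Q c) α x =
      (act (thin k Q) α x.1 + c s t α • pt Q t (coord P s x.2), act (thin k P) α x.2) :=
  act_of (fun v => space (thin k Q) v × space (thin k P) v) _ α x

/-- The inclusion of the subobject of `thinExtension P Q c`. -/
noncomputable def thinExtensionInl (P Q : V → Prop) (c : ∀ s t : V, (s ⟶ t) → k) :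
    thin k Q ⟶ thinExtension P Q c :=
  homMk (fun v => LinearMap.inl k (space (thin k Q) v) (space (thin k P) v)) fun α x =>
    ((act_thinExtension c α (x, 0)).trans
      (Prod.ext (add_eq_left.2 (by simp)) (map_zero (act (thin k P) α)))).symm

/-- The projection to the quotient of `thinExtension P Q c`. -/
noncomputable def thinExtensionSnd (P Q : V → Prop) (c : ∀ s t : V, (s ⟶ t) → k) :
    thinExtension P Q c ⟶ thin k P :=
  homMk (fun v => LinearMap.snd k (space (thin k Q) v) (space (thin k P) v)) fun α x =>
    congrArg Prod.snd (act_thinExtension c α x)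

theorem shortExact_thinExtension (P Q : V → Prop) (c : ∀ s t : V, (s ⟶ t) → k) :
    (ShortComplex.mk (thinExtensionInl P Q c) (thinExtensionSnd P Q c)
      (hom_ext fun _ _ => rfl)).ShortExact :=
  shortExact_mk _ _ _ (fun _ _ _ h => congrArg Prod.fst h) (fun _ y => ⟨(0, y), rfl⟩)
    fun _ y hy => ⟨y.1, Prod.ext rfl (Eq.symm hy)⟩

theorem exists_coboundary_of_section {c : ∀ s t : V, (s ⟶ t) → k}
    {r : thin k P ⟶ thinExtension P Q c} (hr : r ≫ thinExtensionSnd P Q c = 𝟙 _) :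
    ∃ h : V → k, (∀ v, ¬ (P v ∧ Q v) → h v = 0) ∧
      ∀ (s t : V) (α : s ⟶ t), P s → Q t → h t - h s = c s t α := by
  let y (v : V) : space (thin k Q) v × space (thin k P) v := lin r v (pt P v 1)
  have hy (v : V) : (y v).2 = pt P v 1 := congrArg (fun f => lin f v (pt P v 1)) hr
  refine ⟨fun v => coord Q v (y v).1, fun v hv => ?_, fun s t α hs ht => ?_⟩
  · by_cases hQ : Q v
    · have hy₀ : y v = 0 := by
        have hpt : pt P v (1 : k) = 0 := thin_eq_zero (fun h => hv ⟨h, hQ⟩) _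
        exact (congrArg (lin r v) hpt).trans (map_zero (lin r v))
      simp [hy₀]
    · exact coord_eq_zero hQ _
  · have hα : y t = act (thinExtension P Q c) α (y s) :=
      (congrArg (lin r t) (act_pt α hs 1)).symm.trans (lin_act r α _)
    rw [act_thinExtension] at hα
    simp [hα, coord_act α ht, coord_pt ht, hy, coord_pt hs]

theorem subsingleton_ext_thin_iff :
    Subsingleton (Ext.{u + 1} (thin k P) (thin k Q) 1) ↔ CoboundarySurjective k P Q :=
  subsingleton_ext_one_iff.trans
    ⟨fun h c =>
      have ⟨_, hr⟩ := h _ _ _ _ (shortExact_thinExtension P Q c)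
      exists_coboundary_of_section hr,
    fun h _ _ _ _ hS => h.exists_section hS⟩

end ThinExt

section ThinHom

variable {k : Type u} [Field k] {V : Type} [Quiver.{0} V] {P Q : V → Prop}

/-- The morphism of thin representations that is the identity on the intersection of their
supports. -/
noncomputable def thinHom (h : ∀ {s t : V}, (s ⟶ t) → P s → Q t → (P t ↔ Q s)) :
    thin k P ⟶ thin k Q :=
  homMk (fun v => pt Q v ∘ₗ coord P v) fun {s t} α x => thin_ext fun ht => by
    by_cases hs : P s
    · by_cases hQ : Q s
      · simp [coord_act α ht, coord_act α ((h α hs ht).2 hQ), coord_pt hQ, coord_pt ht]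
      · have hP : ¬ P t := fun hP => hQ ((h α hs ht).1 hP)
        simp [coord_eq_zero hP, thin_eq_zero hQ]
    · simp [thin_eq_zero hs x]

theorem exists_shortExact_thin (hPQ : ∀ v, P v → ¬ Q v)
    (h : ∀ {s t : V}, (s ⟶ t) → Q s → ¬ P t) :
    ∃ (i : thin k Q ⟶ thin k fun v => P v ∨ Q v) (p : (thin k fun v => P v ∨ Q v) ⟶ thin k P)
      (w : i ≫ p = 0), (ShortComplex.mk i p w).ShortExact := by
  let R (v : V) : Prop := P v ∨ Q v
  let i : thin k Q ⟶ thin k R :=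
    thinHom fun α hs ht => ⟨fun _ => Or.inr hs, fun _ => ht.resolve_left (h α hs)⟩
  let p : thin k R ⟶ thin k P :=
    thinHom fun α hs ht => ⟨fun _ => hs.resolve_right fun hs => h α hs ht, fun _ => Or.inl ht⟩
  have hi (v x) : lin i v x = pt R v (coord Q v x) := rfl
  have hp (v x) : lin p v x = pt P v (coord R v x) := rfl
  refine ⟨i, p, hom_ext fun v x => thin_ext fun hv => ?_,
    shortExact_mk i p _ (fun v x y hxy => thin_ext fun hv => ?_)
      (fun v y => ⟨pt R v (coord P v y), thin_ext fun hv => ?_⟩)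
      fun v y hy => ⟨pt Q v (coord R v y), thin_ext fun hv => ?_⟩⟩
  · rw [lin_comp, thin_eq_zero (hPQ v hv) x, map_zero, map_zero, lin_zero]
  · have hR : R v := Or.inr hv
    rw [← coord_pt (P := R) hR (coord Q v x), ← hi, hxy, hi, coord_pt hR]
  · have hR : R v := Or.inl hv
    rw [hp, coord_pt hv, coord_pt hR]
  · rw [hi, coord_pt hv]
    by_cases hv' : P v
    · rw [coord_eq_zero (hPQ v hv'), ← coord_pt hv' (coord R v y), ← hp, hy, map_zero]
    · rw [coord_pt (hv.resolve_left hv')]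

theorem extGeneratedByIndecomposable_thin (hP : IsConnectedSupport P)
    (hR : IsConnectedSupport fun v => P v ∨ Q v) (hQ : ∃ v, Q v) (hPQ : ∀ v, P v → ¬ Q v)
    (h : ∀ {s t : V}, (s ⟶ t) → Q s → ¬ P t)
    (hPR : CoboundarySurjective k P fun v => P v ∨ Q v) :
    ExtGeneratedByIndecomposable (thin k P) (thin k Q) := by
  obtain ⟨i, p, w, hS⟩ := exists_shortExact_thin (k := k) hPQ h
  have := subsingleton_ext_thin_iff.2 hPR
  refine extGeneratedByIndecomposable_of_shortExact hS (isBrick_thin hP)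
    (isBrick_thin hR).indecomposable ?_
  rintro ⟨s, hs⟩
  obtain ⟨v, hv⟩ := hQ
  exact (isBrick_thin hP).id_ne_zero
    (hs ▸ thin_comp_eq_zero hP hR (v := v) (fun h => hPQ v (h.2 (Or.inr hv)) hv) s p)

end ThinHom

end QuiverRep

/-! ### Interval representations -/

section Potential

variable (k : Type*) [Field k]

theorem not_forall_exists_potential {l r : ℕ} (hl : 0 < l) (hlr : l ≤ r) :
    ¬ ∀ e : ℕ → k, ∃ g : ℕ → k, (∀ v, ¬ (l ≤ v ∧ v < r) → g v = 0) ∧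
      ∀ j, l ≤ j + 1 → j + 1 ≤ r → g (j + 1) - g j = e j := by
  intro H
  obtain ⟨g, hg₀, hg⟩ := H fun j => if j = r - 1 then 1 else 0
  have hsum : ∑ j ∈ Finset.Ico (l - 1) r, (g (j + 1) - g j) = 0 := by
    rw [Finset.sum_Ico_sub _ (by omega), hg₀ r (by omega), hg₀ (l - 1) (by omega), sub_zero]
  have hone : ∑ j ∈ Finset.Ico (l - 1) r, (g (j + 1) - g j) = 1 := by
    rw [Finset.sum_congr rfl fun j hj => hg j (by grind) (by grind), Finset.sum_ite_eq',
      if_pos (by grind)]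
  exact zero_ne_one (hsum.symm.trans hone)

/-- A potential on `l, …, r - 1`, extended by zero, with prescribed differences along the edges from
`j` to `j + 1` for `l ≤ j < r - 1`, and also along the boundary edge at `l` if `L` and along the one
at `r` if `R`. -/
theorem forall_exists_potential_iff {l r : ℕ} {L R : Prop} (hL : L → 0 < l) :
    (∀ e : ℕ → k, ∃ g : ℕ → k, (∀ v, ¬ (l ≤ v ∧ v < r) → g v = 0) ∧
      ∀ j, l ≤ j + 1 → j + 1 ≤ r → (j + 1 = l → L) → (j + 1 = r → R) → g (j + 1) - g j = e j) ↔
    ¬ (l ≤ r ∧ L ∧ R) := by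
  classical
  refine ⟨fun H ⟨hlr, hl, hr⟩ => not_forall_exists_potential k (hL hl) hlr fun e => ?_,
    fun H e => ?_⟩
  · obtain ⟨g, hg₀, hg⟩ := H e
    exact ⟨g, hg₀, fun j h₁ h₂ => hg j h₁ h₂ (fun _ => hl) fun _ => hr⟩
  · let C (v : ℕ) : k := ∑ j ∈ Finset.range v, e j
    let γ : ℕ := if R then r else l - 1
    let g (v : ℕ) : k := if l ≤ v ∧ v < r then C v - C γ else 0
    refine ⟨g, fun v hv => if_neg hv, fun j h₁ h₂ hl hr => ?_⟩
    have hj : g j = C j - C γ := by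
      by_cases h : l ≤ j
      · exact if_pos ⟨h, h₂⟩
      · have hR : ¬ R := fun hR => H ⟨h₁.trans h₂, hl (by omega), hR⟩
        have hγ : γ = j := (if_neg hR).trans (by omega)
        rw [hγ, sub_self]
        exact if_neg fun h' => h h'.1
    have hj' : g (j + 1) = C (j + 1) - C γ := by
      by_cases h : j + 1 < r
      · exact if_pos ⟨h₁, h⟩
      · have hγ : γ = j + 1 := by grind
        rw [hγ, sub_self]
        exact if_neg fun h' => h h'.2
    rw [hj, hj', sub_sub_sub_cancel_right]
    exact sub_eq_of_eq_add' (Finset.sum_range_succ e j)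

end Potential

namespace TypeA

variable {n : ℕ} {ε : Fin (n + 1) → Bool}

/-- The number of a vertex. -/
def idx (v : TypeA n ε) : ℕ := Fin.val (n := n + 2) v

variable (ε) in
/-- The vertex with a given number, where numbers larger than `n + 1` give the last vertex. -/
def vertex (j : ℕ) : TypeA n ε := (⟨min j (n + 1), by omega⟩ : Fin (n + 2))

theorem idx_lt (v : TypeA n ε) : idx v < n + 2 := Fin.isLt (n := n + 2) v

theorem idx_vertex {j : ℕ} (h : j < n + 2) : idx (vertex ε j) = j := min_eq_left (by omega)

theorem vertex_idx (v : TypeA n ε) : vertex ε (idx v) = v :=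
  Fin.ext (min_eq_left (Nat.le_of_lt_succ (idx_lt v)))

instance : Finite (TypeA n ε) := inferInstanceAs (Finite (Fin (n + 2)))

/-- The numbers of the vertices at which an arrow `t - 1 ⟶ t` ends. In the polygon with vertices
`0, …, n + 2`, arranged by abscissa, these are the vertices on the upper side. -/
def IsUpper (ε : Fin (n + 1) → Bool) (t : ℕ) : Prop :=
  ∃ i : Fin (n + 1), i.val + 1 = t ∧ ε i = true

theorem vertex_castSucc (i : Fin (n + 1)) : vertex ε i = i.castSucc :=
  vertex_idx (ε := ε) i.castSucc

theorem vertex_succ (i : Fin (n + 1)) : vertex ε (i + 1) = i.succ := vertex_idx (ε := ε) i.succ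

theorem nonempty_hom_succ {i : ℕ} (h : IsUpper ε (i + 1)) :
    Nonempty (vertex ε i ⟶ vertex ε (i + 1)) := by
  obtain ⟨j, hj, hε⟩ := h
  obtain rfl : j.val = i := Nat.succ_injective hj
  rw [vertex_castSucc, vertex_succ]
  exact ⟨Arrow.right j hε⟩

theorem nonempty_hom_pred {i : ℕ} (hi : i < n + 1) (h : ¬ IsUpper ε (i + 1)) :
    Nonempty (vertex ε (i + 1) ⟶ vertex ε i) := by
  lift i to Fin (n + 1) using hi
  rw [vertex_castSucc, vertex_succ]
  exact ⟨Arrow.left i (by simpa using fun hε => h ⟨i, rfl, hε⟩)⟩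

theorem exists_eq_vertex {s t : TypeA n ε} (α : s ⟶ t) : ∃ i < n + 1,
    (s = vertex ε i ∧ t = vertex ε (i + 1) ∧ IsUpper ε (i + 1)) ∨
      (s = vertex ε (i + 1) ∧ t = vertex ε i ∧ ¬ IsUpper ε (i + 1)) := by
  rcases α with ⟨i, hi⟩ | ⟨i, hi⟩
  · exact ⟨i, i.2, Or.inl ⟨(vertex_castSucc i).symm, (vertex_succ i).symm, i, rfl, hi⟩⟩
  · refine ⟨i, i.2, Or.inr ⟨(vertex_succ i).symm, (vertex_castSucc i).symm, ?_⟩⟩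
    rintro ⟨j, hj, hε⟩
    obtain rfl : j = i := Fin.ext (Nat.succ_injective hj)
    simp [hε] at hi

theorem heq_of_arrow {s t s' t' : TypeA n ε} (α : s ⟶ t) (β : s' ⟶ t') (hs : s = s')
    (ht : t = t') : HEq α β := by
  rcases α with ⟨i, hi⟩ | ⟨i, hi⟩ <;> rcases β with ⟨j, hj⟩ | ⟨j, hj⟩
  · obtain rfl := Fin.castSucc_injective _ hs
    rfl
  · have hs := congrArg Fin.val hs
    have ht := congrArg Fin.val ht
    simp only [Fin.val_castSucc, Fin.val_succ] at hs ht
    omega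
  · have hs := congrArg Fin.val hs
    have ht := congrArg Fin.val ht
    simp only [Fin.val_castSucc, Fin.val_succ] at hs ht
    omega
  · obtain rfl := Fin.succ_injective _ hs
    rfl

instance (s t : TypeA n ε) : Subsingleton (s ⟶ t) :=
  ⟨fun α β => eq_of_heq (heq_of_arrow α β rfl rfl)⟩

/-- The vertices from `a` to `b - 1`. -/
def interval (ε : Fin (n + 1) → Bool) (a b : ℕ) (v : TypeA n ε) : Prop := a ≤ idx v ∧ idx v < b

theorem interval_vertex {a b j : ℕ} (hj : j < n + 2) :
    interval ε a b (vertex ε j) ↔ a ≤ j ∧ j < b := by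
  rw [interval, idx_vertex hj]

theorem isConnectedSupport_interval {a b : ℕ} (hab : a < b) (hb : b ≤ n + 2) :
    QuiverRep.IsConnectedSupport (interval ε a b) := by
  have hmem (j : ℕ) (ha : a ≤ j) (hj : j < b) : interval ε a b (vertex ε j) :=
    (interval_vertex (by omega)).2 ⟨ha, hj⟩
  refine ⟨⟨vertex ε a, hmem a le_rfl hab⟩, fun v w hv hw => ?_⟩
  have key (j : ℕ) (ha : a ≤ j) (hj : j < b) : Relation.EqvGen (fun s t => interval ε a b s ∧
      interval ε a b t ∧ Nonempty (s ⟶ t)) (vertex ε a) (vertex ε j) := by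
    induction j, ha using Nat.le_induction with
    | base => exact .refl _
    | succ j ha ih =>
      refine (ih (by omega)).trans _ _ _ ?_
      by_cases hU : IsUpper ε (j + 1)
      · exact .rel _ _ ⟨hmem _ ha (by omega), hmem _ (by omega) hj, nonempty_hom_succ hU⟩
      · exact .symm _ _ (.rel _ _
          ⟨hmem _ (by omega) hj, hmem _ ha (by omega), nonempty_hom_pred (by omega) hU⟩)
  rw [← vertex_idx v, ← vertex_idx w]
  exact .trans _ _ _ (.symm _ _ (key _ hv.1 hv.2)) (key _ hw.1 hw.2)

end TypeA

/-- In the polygon whose vertices are arranged by abscissa, those with `U` on the upper side, the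
chord from `a` to `b` passes below the one from `c` to `d` at the left end of their common range
of abscissas, and above it at the right end. -/
def Traverses (U : ℕ → Prop) (a b c d : ℕ) : Prop :=
  a ⊔ c ≤ b ⊓ d ∧ (a < c ∧ U c ∨ c < a ∧ ¬ U a) ∧ (b < d ∧ U b ∨ d < b ∧ ¬ U d)

namespace TypeA

variable {n : ℕ} {ε : Fin (n + 1) → Bool}

theorem exists_arrow_iff {U : ℕ → Prop} {a b c d j : ℕ} :
    (U (j + 1) ∧ (a ≤ j ∧ j < b) ∧ (c ≤ j + 1 ∧ j + 1 < d) ∨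
      ¬ U (j + 1) ∧ (a ≤ j + 1 ∧ j + 1 < b) ∧ (c ≤ j ∧ j < d)) ↔
    a ⊔ c ≤ j + 1 ∧ j + 1 ≤ b ⊓ d ∧ (j + 1 = a ⊔ c → (a < c ∧ U c ∨ c < a ∧ ¬ U a)) ∧
      (j + 1 = b ⊓ d → (b < d ∧ U b ∨ d < b ∧ ¬ U d)) := by
  by_cases hU : U (j + 1) <;> grind (splits := 20)

section Coboundary

variable {k : Type u} [Field k] {a b c d : ℕ}

theorem not_traverses_of_coboundarySurjective (hb : b ≤ n + 2) (hd : d ≤ n + 2)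
    (H : QuiverRep.CoboundarySurjective k (interval ε a b) (interval ε c d)) :
    ¬ Traverses (IsUpper ε) a b c d := by
  refine (forall_exists_potential_iff k (by omega)).1 fun e => ?_
  obtain ⟨f, hf₀, hf⟩ := H fun s t _ => if idx s < idx t then e (idx s) else - e (idx t)
  refine ⟨fun v => if v < n + 2 then f (vertex ε v) else 0, fun v hv => ?_,
    fun j h₁ h₂ hl hr => ?_⟩
  · refine ite_eq_right_iff.2 fun hv' => hf₀ _ ?_
    rw [interval_vertex hv', interval_vertex hv']
    omega
  · have hj : j < n + 1 := by omega
    beta_reduce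
    rw [if_pos (by omega), if_pos (by omega)]
    obtain ⟨hU, h, h'⟩ | ⟨hU, h, h'⟩ := exists_arrow_iff.2 ⟨h₁, h₂, hl, hr⟩
    · have := hf _ _ (nonempty_hom_succ hU).some
        ((interval_vertex (by omega)).2 h) ((interval_vertex (by omega)).2 h')
      simpa [idx_vertex, hj, hj.trans] using this
    · have := hf _ _ (nonempty_hom_pred hj hU).some
        ((interval_vertex (by omega)).2 h) ((interval_vertex (by omega)).2 h')
      rw [← neg_sub, this]
      simp [idx_vertex, hj, hj.trans]

theorem coboundarySurjective_of_not_traverses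
    (H : ¬ Traverses (IsUpper ε) a b c d) :
    QuiverRep.CoboundarySurjective k (interval ε a b) (interval ε c d) := by
  classical
  intro c'
  obtain ⟨f, hf₀, hf⟩ := (forall_exists_potential_iff k (by omega)).2 H fun j =>
    if hU : IsUpper ε (j + 1) then c' _ _ (nonempty_hom_succ hU).some
    else if hj : j < n + 1 then - c' _ _ (nonempty_hom_pred hj hU).some else 0
  refine ⟨fun v => f (idx v), fun v hv => hf₀ _ fun h => hv ?_, fun s t α hs ht => ?_⟩
  · simp only [interval]
    omega
  · obtain ⟨j, hj, ⟨rfl, rfl, hU⟩ | ⟨rfl, rfl, hU⟩⟩ := exists_eq_vertex α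
    all_goals
      rw [interval_vertex (by omega)] at hs ht
      beta_reduce
      rw [Subsingleton.elim α (Nonempty.some ⟨α⟩), idx_vertex (by omega), idx_vertex (by omega)]
    · obtain ⟨h₁, h₂, hl, hr⟩ := exists_arrow_iff.1 (Or.inl ⟨hU, hs, ht⟩)
      rw [hf j h₁ h₂ hl hr, dif_pos hU]
    · obtain ⟨h₁, h₂, hl, hr⟩ := exists_arrow_iff.1 (Or.inr ⟨hU, hs, ht⟩)
      rw [← neg_sub, hf j h₁ h₂ hl hr, dif_neg hU, dif_pos hj, neg_neg]

end Coboundary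

end TypeA

/-! ### Chords and extensions -/

/-- The chords of a polygon with vertices `0, …, n + 2`. Here and below its edges are regarded as
chords. -/
abbrev Chord (n : ℕ) : Type := {p : ℕ × ℕ // p.1 < p.2 ∧ p.2 ≤ n + 2}

/-- The crossing of two chords of the polygon whose vertices are arranged by abscissa, those with
`U` on the upper side: one of the chords passes below the other at one end of their common range of
abscissas, and above it at the other end. -/
def Crosses {n : ℕ} (U : ℕ → Prop) (p q : Chord n) : Prop :=
  p.1.1 ⊔ q.1.1 < p.1.2 ⊓ q.1.2 ∧
    (Traverses U p.1.1 p.1.2 q.1.1 q.1.2 ∨ Traverses U q.1.1 q.1.2 p.1.1 p.1.2)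

/-- A set without crossings of two of its elements, for a given crossing relation. -/
def IsNoncrossing {α : Type*} (R : α → α → Prop) (S : Set α) : Prop :=
  ∀ p ∈ S, ∀ q ∈ S, ¬ R p q

namespace QuiverRep

open TypeA

variable {k : Type u} [Field k] {n : ℕ} {ε : Fin (n + 1) → Bool} {a b c : ℕ}

theorem interval_or_interval (hab : a ≤ b) (hbc : b ≤ c) (v : TypeA n ε) :
    (interval ε a b v ∨ interval ε b c v) ↔ interval ε a c v := by
  simp only [interval]
  omega

theorem not_interval_of_interval {v : TypeA n ε} (h : interval ε a b v) : ¬ interval ε b c v := by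
  simp only [interval] at h ⊢
  omega

theorem isUpper_of_hom {s t : TypeA n ε} (α : s ⟶ t) (hs : interval ε a b s)
    (ht : interval ε b c t) : IsUpper ε b := by
  obtain ⟨j, hj, ⟨rfl, rfl, hU⟩ | ⟨rfl, rfl, -⟩⟩ := exists_eq_vertex α <;>
    rw [interval_vertex (by omega)] at hs ht
  · obtain rfl : j + 1 = b := by omega
    exact hU
  · omega

theorem not_isUpper_of_hom {s t : TypeA n ε} (α : s ⟶ t) (hs : interval ε b c s)
    (ht : interval ε a b t) : ¬ IsUpper ε b := by
  obtain ⟨j, hj, ⟨rfl, rfl, -⟩ | ⟨rfl, rfl, hU⟩⟩ := exists_eq_vertex α <;>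
    rw [interval_vertex (by omega)] at hs ht
  · omega
  · obtain rfl : j + 1 = b := by omega
    exact hU

theorem extGeneratedByIndecomposable_of_isUpper (hab : a < b) (hbc : b < c) (hc : c ≤ n + 2)
    (hb : IsUpper ε b) :
    ExtGeneratedByIndecomposable (thin k (interval ε a b)) (thin k (interval ε b c)) := by
  have hE : (fun v => interval ε a b v ∨ interval ε b c v) = interval ε a c :=
    funext fun v => propext (interval_or_interval hab.le hbc.le v)
  refine extGeneratedByIndecomposable_thin (isConnectedSupport_interval hab (by omega)) ?_
    (isConnectedSupport_interval hbc hc).1 (fun v => not_interval_of_interval)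
    (fun α hs ht => not_isUpper_of_hom α hs ht hb) ?_ <;> rw [hE]
  · exact isConnectedSupport_interval (hab.trans hbc) hc
  · exact coboundarySurjective_of_not_traverses fun h => by
      rcases h.2.1 with h | h <;> omega

theorem extGeneratedByIndecomposable_of_not_isUpper (hab : a < b) (hbc : b < c) (hc : c ≤ n + 2)
    (hb : ¬ IsUpper ε b) :
    ExtGeneratedByIndecomposable (thin k (interval ε b c)) (thin k (interval ε a b)) := by
  have hE : (fun v => interval ε b c v ∨ interval ε a b v) = interval ε a c :=
    funext fun v => propext (or_comm.trans (interval_or_interval hab.le hbc.le v))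
  refine extGeneratedByIndecomposable_thin (isConnectedSupport_interval hbc hc) ?_
    (isConnectedSupport_interval hab (by omega)).1
    (fun v h h' => not_interval_of_interval h' h)
    (fun α hs ht => hb (isUpper_of_hom α hs ht)) ?_ <;> rw [hE]
  · exact isConnectedSupport_interval (hab.trans hbc) hc
  · exact coboundarySurjective_of_not_traverses fun h => by
      rcases h.2.2 with h | h <;> omega

variable (k ε) in
/-- The representation attached to a chord: the thin representation on the interval between its
ends. -/
noncomputable def chordRep (p : Chord n) : QuiverRep k (TypeA n ε) :=
  thin k (interval ε p.1.1 p.1.2)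

theorem isExtAdmissible_chordRep {p q : Chord n} (h : ¬ Crosses (IsUpper ε) p q) :
    IsExtAdmissible (chordRep k ε p) (chordRep k ε q) := by
  obtain ⟨⟨a, b⟩, hab, hb⟩ := p
  obtain ⟨⟨c, d⟩, hcd, hd⟩ := q
  by_cases hT : Traverses (IsUpper ε) a b c d
  · have hlr : ¬ a ⊔ c < b ⊓ d := fun hlr => h ⟨hlr, Or.inl hT⟩
    obtain ⟨hle, hl, -⟩ := hT
    dsimp only at hab hb hcd hd
    obtain rfl | rfl : b = c ∨ d = a := by omega
    · exact Or.inr (extGeneratedByIndecomposable_of_isUpper hab hcd hd (by grind))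
    · exact Or.inr (extGeneratedByIndecomposable_of_not_isUpper hcd hab hb (by grind))
  · exact Or.inl (subsingleton_ext_thin_iff.2 (coboundarySurjective_of_not_traverses hT))

theorem not_isExtAdmissible_chordRep (hM : IsBrickSystem (chordRep k ε)) {p q : Chord n}
    (h : p.1.1 ⊔ q.1.1 < p.1.2 ⊓ q.1.2)
    (hT : Traverses (IsUpper ε) p.1.1 p.1.2 q.1.1 q.1.2) :
    ¬ IsExtAdmissible (chordRep k ε p) (chordRep k ε q) := by
  rintro (hs | ⟨-, E, i, p', w, hS, hE, -⟩)
  · exact not_traverses_of_coboundarySurjective p.2.2 q.2.2 (subsingleton_ext_thin_iff.1 hs) hT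
  · -- At a common vertex the middle term has dimension two, which no indecomposable has.
    have := p.2
    let v : TypeA n ε := vertex ε (p.1.1 ⊔ q.1.1)
    have hv (r : Chord n) (hr : r.1.1 ≤ p.1.1 ⊔ q.1.1 ∧ p.1.1 ⊔ q.1.1 < r.1.2) :
        Module.finrank k (space (chordRep k ε r) v) = 1 :=
      finrank_thin ((interval_vertex (by omega)).2 hr)
    obtain ⟨r, ⟨e⟩⟩ := hM.exists_iso hE
    have hdim := finrank_of_shortExact hS v
    rw [(spaceEquiv e v).finrank_eq, hv p (by omega), hv q (by omega)] at hdim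
    have hle : Module.finrank k (space (chordRep k ε r) v) ≤ 1 := finrank_thin_le v
    omega

theorem not_crosses_iff (hM : IsBrickSystem (chordRep k ε)) {p q : Chord n} :
    ¬ Crosses (IsUpper ε) p q ↔ IsExtAdmissible (chordRep k ε p) (chordRep k ε q) ∧
      IsExtAdmissible (chordRep k ε q) (chordRep k ε p) := by
  have hsymm : Crosses (IsUpper ε) q p ↔ Crosses (IsUpper ε) p q := by
    rw [Crosses, Crosses, sup_comm, inf_comm, or_comm]
  refine ⟨fun h => ⟨isExtAdmissible_chordRep h, isExtAdmissible_chordRep (hsymm.not.2 h)⟩, ?_⟩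
  rintro ⟨hpq, hqp⟩ ⟨h, hT | hT⟩
  · exact not_isExtAdmissible_chordRep hM h hT hpq
  · exact not_isExtAdmissible_chordRep hM (by rwa [sup_comm, inf_comm]) hT hqp

theorem isExtClique_chordRep (hM : IsBrickSystem (chordRep k ε)) :
    IsExtClique (chordRep k ε) = IsNoncrossing (Crosses (IsUpper ε)) := by
  ext S
  simp only [IsNoncrossing, not_crosses_iff hM, IsExtClique]
  exact ⟨fun h p hp q hq => ⟨h p hp q hq, h q hq p hp⟩, fun h p hp q hq => (h p hp q hq).1⟩

end QuiverRep

/-! ### Sequences of linear relations -/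

namespace LinearRelations

variable {k : Type u} [Field k] {E : ℕ → Type v} [∀ i, AddCommGroup (E i)] [∀ i, Module k (E i)]
  {ρ : ∀ i, Submodule k (E i × E (i + 1))} {a b c : ℕ} {x : ∀ i, E i}
  {φ : ∀ i, Module.Dual k (E i)}

variable (ρ) in
/-- The families of vectors whose members from `a` to `b` are successively related. -/
def chains (a b : ℕ) : Submodule k (∀ i, E i) where
  carrier := {x | ∀ i, a ≤ i → i < b → (x i, x (i + 1)) ∈ ρ i}
  add_mem' hx hy i ha hb := (ρ i).add_mem (hx i ha hb) (hy i ha hb)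
  zero_mem' i _ _ := (ρ i).zero_mem
  smul_mem' c _ hx i ha hb := (ρ i).smul_mem c (hx i ha hb)

variable (ρ) in
/-- The members from `a` to `b` of a family of linear forms agree on related vectors. -/
def IsDualChain (a b : ℕ) (φ : ∀ i, Module.Dual k (E i)) : Prop :=
  ∀ i, a ≤ i → i < b → ∀ z ∈ ρ i, φ i z.1 = φ (i + 1) z.2

theorem chains_anti (h : b ≤ c) : chains ρ a c ≤ chains ρ a b :=
  fun _ hx i ha hb => hx i ha (hb.trans_le h)

theorem update_mem_chains (hx : x ∈ chains ρ a b) {y : E (b + 1)} (hy : (x b, y) ∈ ρ b) :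
    Function.update x (b + 1) y ∈ chains ρ a (b + 1) := by
  intro i ha hib
  rw [Function.update_of_ne (by omega)]
  obtain hib | rfl := Nat.lt_succ_iff_lt_or_eq.1 hib
  · rw [Function.update_of_ne (by omega)]
    exact hx i ha hib
  · rwa [Function.update_self]

theorem exists_comp_eq_of_ker_le {M : Type v} {N : Type w} [AddCommGroup M] [Module k M]
    [AddCommGroup N] [Module k N] (p : M →ₗ[k] N) (l : Module.Dual k M)
    (h : ∀ m, p m = 0 → l m = 0) : ∃ ψ : Module.Dual k N, ∀ m, ψ (p m) = l m := by
  have : l ∈ LinearMap.range p.dualMap := by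
    rw [LinearMap.range_dualMap_eq_dualAnnihilator_ker, Submodule.mem_dualAnnihilator]
    exact h
  obtain ⟨ψ, rfl⟩ := this
  exact ⟨ψ, fun m => rfl⟩

theorem exists_dual_step {φa : Module.Dual k (E a)} {φb : Module.Dual k (E (b + 1))} (hab : a ≤ b)
    (h : ∀ x ∈ chains ρ a (b + 1), φa (x a) = φb (x (b + 1))) :
    ∃ ψ : Module.Dual k (E b), (∀ x ∈ chains ρ a b, φa (x a) = ψ (x b)) ∧
      ∀ z ∈ ρ b, ψ z.1 = φb z.2 := by
  let ev (i : ℕ) : chains ρ a b →ₗ[k] E i := LinearMap.proj i ∘ₗ (chains ρ a b).subtype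
  obtain ⟨ψ, hψ⟩ := exists_comp_eq_of_ker_le
    ((ev b).coprod (LinearMap.fst k _ _ ∘ₗ (ρ b).subtype))
    ((φa ∘ₗ ev a).coprod (φb ∘ₗ LinearMap.snd k _ _ ∘ₗ (ρ b).subtype)) (by
      rintro ⟨⟨x, hx⟩, ⟨z, hz⟩⟩ h₀
      have hxz : x b = (-z).1 := eq_neg_of_add_eq_zero_left h₀
      have := h _ (update_mem_chains hx (y := (-z).2) (hxz ▸ (ρ b).neg_mem hz))
      rw [Function.update_self, Function.update_of_ne (by omega)] at this
      simp [ev, this])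
  exact ⟨ψ, fun x hx => by simpa [ev] using (hψ (⟨x, hx⟩, 0)).symm,
    fun z hz => by simpa [ev] using hψ (0, ⟨z, hz⟩)⟩

theorem exists_isDualChain (hab : a ≤ b) {φa : Module.Dual k (E a)} {φb : Module.Dual k (E b)}
    (h : ∀ x ∈ chains ρ a b, φa (x a) = φb (x b)) :
    ∃ φ, IsDualChain ρ a b φ ∧ φ a = φa ∧ φ b = φb := by
  induction b, hab using Nat.le_induction with
  | base =>
    refine ⟨Function.update 0 a φa, fun i _ _ => by omega, by simp, ?_⟩
    ext y
    simpa using h (Function.update 0 a y) (fun i _ _ => by omega)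
  | succ b hab ih =>
    obtain ⟨ψ, hψ, hψb⟩ := exists_dual_step hab h
    obtain ⟨φ, hφ, rfl, rfl⟩ := ih hψ
    refine ⟨Function.update φ (b + 1) φb, fun i ha hib => ?_, Function.update_of_ne (by omega) _ _,
      Function.update_self _ _ _⟩
    rw [Function.update_of_ne (by omega)]
    obtain hib | rfl := Nat.lt_succ_iff_lt_or_eq.1 hib
    · rw [Function.update_of_ne (by omega)]
      exact hφ i ha hib
    · rwa [Function.update_self]

variable (ρ) in
/-- Every vector at `a` starts a chain up to `b`, and no nonzero vector starts one that vanishes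
at `b`. -/
def Persists (a b : ℕ) : Prop :=
  (∀ y, ∃ x ∈ chains ρ a b, x a = y) ∧ ∀ x ∈ chains ρ a b, x b = 0 → x a = 0

theorem persists_self : Persists ρ a a :=
  ⟨fun y => ⟨Function.update 0 a y, fun i _ _ => by omega, Function.update_self _ _ _⟩,
    fun _ _ h => h⟩

variable (ρ) in
/-- A chain and a dual chain from `a` to `b` that pair to `1` and of which one, extended by zero,
is compatible with the relation following `b`. -/
structure IsSplitPair (a b : ℕ) (x : ∀ i, E i) (φ : ∀ i, Module.Dual k (E i)) : Prop where
  mem_chains : x ∈ chains ρ a b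
  isDualChain : IsDualChain ρ a b φ
  pairing_left : φ a (x a) = 1
  terminates : (x b, 0) ∈ ρ b ∨ ∀ z ∈ ρ b, φ b z.1 = 0

theorem IsSplitPair.pairing (h : IsSplitPair ρ a b x φ) {j : ℕ} (ha : a ≤ j) (hb : j ≤ b) :
    φ j (x j) = 1 := by
  induction j, ha using Nat.le_induction with
  | base => exact h.pairing_left
  | succ j ha ih =>
    rw [← ih (by omega)]
    exact (h.isDualChain j ha hb _ (h.mem_chains j ha hb)).symm

theorem Persists.exists_isSplitPair_of_mem (h : Persists ρ a b) (hab : a ≤ b)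
    (hx : x ∈ chains ρ a b) (hxa : x a ≠ 0) (hxb : (x b, 0) ∈ ρ b) :
    ∃ φ, IsSplitPair ρ a b x φ := by
  obtain ⟨φa, hφa⟩ := Module.Projective.exists_dual_eq_one k hxa
  let ev (i : ℕ) : chains ρ a b →ₗ[k] E i := LinearMap.proj i ∘ₗ (chains ρ a b).subtype
  obtain ⟨φb, hφb⟩ := exists_comp_eq_of_ker_le (ev b) (φa ∘ₗ ev a)
    fun y hy => (congrArg φa (h.2 y.1 y.2 hy)).trans (map_zero φa)
  obtain ⟨φ, hφ, rfl, -⟩ := exists_isDualChain hab fun y hy => (hφb ⟨y, hy⟩).symm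
  exact ⟨φ, hx, hφ, hφa, Or.inl hxb⟩

theorem Persists.exists_isSplitPair_of_forall_ne (h : Persists ρ a b) (hab : a ≤ b) {y : E a}
    (hy : ∀ x ∈ chains ρ a (b + 1), x a ≠ y) : ∃ x φ, IsSplitPair ρ a b x φ := by
  obtain ⟨φa, hφy, hφa⟩ := LinearMap.exists_extend_of_notMem
    (p := (chains ρ a (b + 1)).map (LinearMap.proj (R := k) a)) (0 : _ →ₗ[k] k)
    (v := y) (by rintro ⟨x, hx, hxy⟩; exact hy x hx hxy) 1
  obtain ⟨φ, hφ, rfl, hφb⟩ := exists_isDualChain (b := b + 1) (φb := 0) (by omega)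
    fun x hx => congrArg (fun f => f ⟨_, x, hx, rfl⟩) hφy
  obtain ⟨x, hx, rfl⟩ := h.1 y
  refine ⟨x, φ, hx, fun i ha hb => hφ i ha (by omega), hφa, Or.inr fun z hz => ?_⟩
  rw [hφ b hab (Nat.lt_succ_self b) z hz, hφb, LinearMap.zero_apply]

theorem persists_or_exists_isSplitPair (hac : a ≤ c) :
    Persists ρ a c ∨ ∃ b x φ, a ≤ b ∧ b < c ∧ IsSplitPair ρ a b x φ := by
  induction c, hac using Nat.le_induction with
  | base => exact Or.inl persists_self
  | succ b hab ih =>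
    obtain h | ⟨d, x, φ, had, hdb, hd⟩ := ih
    · by_contra! hcon
      obtain ⟨hnot, hcon⟩ := hcon
      refine hnot ⟨fun y => ?_, fun x hx hxb => ?_⟩ <;> by_contra! hne
      · obtain ⟨x, φ, hxφ⟩ := h.exists_isSplitPair_of_forall_ne hab hne
        exact hcon b x φ hab (Nat.lt_succ_self b) hxφ
      · obtain ⟨φ, hxφ⟩ := h.exists_isSplitPair_of_mem hab (chains_anti (Nat.le_succ b) hx) hne
          (hxb ▸ hx b hab (Nat.lt_succ_self b))
        exact hcon b x φ hab (Nat.lt_succ_self b) hxφ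
    · exact Or.inr ⟨d, x, φ, had, by omega, hd⟩

theorem exists_isSplitPair [Nontrivial (E a)] (hac : a ≤ c) (hc : ∀ y, (y, 0) ∈ ρ c) :
    ∃ b x φ, a ≤ b ∧ b ≤ c ∧ IsSplitPair ρ a b x φ := by
  obtain h | ⟨b, x, φ, hab, hbc, h⟩ := persists_or_exists_isSplitPair (ρ := ρ) hac
  · obtain ⟨y, hy⟩ := exists_ne (0 : E a)
    obtain ⟨x, hx, rfl⟩ := h.1 y
    obtain ⟨φ, hφ⟩ := h.exists_isSplitPair_of_mem hac hx hy (hc _)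
    exact ⟨c, x, φ, hac, le_rfl, hφ⟩
  · exact ⟨b, x, φ, hab, hbc.le, h⟩

end LinearRelations

/-! ### Interval summands -/

namespace TypeA

variable {n : ℕ} {ε : Fin (n + 1) → Bool}

theorem exists_vertex_eq (v : TypeA n ε) : ∃ j < n + 2, vertex ε j = v :=
  ⟨idx v, idx_lt v, vertex_idx v⟩

theorem eq_of_vertex_eq {i j : ℕ} (hi : i < n + 2) (hj : j < n + 2)
    (h : vertex ε i = vertex ε j) : i = j := by
  rw [← idx_vertex hi, h, idx_vertex hj]

theorem exists_forall_vertex_eq {F : TypeA n ε → Type*} (x : ∀ j, F (vertex ε j)) :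
    ∃ y : ∀ v, F v, ∀ j < n + 2, y (vertex ε j) = x j := by
  refine ⟨fun v => vertex_idx v ▸ x (idx v), fun j hj => ?_⟩
  have key (i : ℕ) (hi : i = j) (h : vertex ε i = vertex ε j) : h ▸ x i = x j := by
    subst hi
    rfl
  exact key _ (idx_vertex hj) _

theorem isEmpty_hom_of_hom {s t : TypeA n ε} (α : s ⟶ t) : IsEmpty (t ⟶ s) := by
  refine ⟨fun β => ?_⟩
  obtain ⟨i, hi, h⟩ := exists_eq_vertex α
  obtain ⟨j, hj, h'⟩ := exists_eq_vertex β
  rcases h with ⟨rfl, rfl, hU⟩ | ⟨rfl, rfl, hU⟩ <;> rcases h' with ⟨hs, ht, hU'⟩ | ⟨hs, ht, hU'⟩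
  all_goals
    replace hs := eq_of_vertex_eq (by omega) (by omega) hs
    replace ht := eq_of_vertex_eq (by omega) (by omega) ht
  · omega
  · exact hU' (hs ▸ hU)
  · exact hU (ht ▸ hU')
  · omega

end TypeA

namespace QuiverRep

open TypeA LinearRelations

variable {k : Type u} [Field k] {n : ℕ} {ε : Fin (n + 1) → Bool} {X : QuiverRep k (TypeA n ε)}
  {a b : ℕ} {x : ∀ j, space X (vertex ε j)} {φ : ∀ j, Module.Dual k (space X (vertex ε j))}

variable (X) in
/-- The relation given by the map of the edge between the vertices `j` and `j + 1`: its graph, or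
the transpose of its graph. For `j = n + 1` there is no edge, and any two vectors are related. -/
def edge (j : ℕ) : Submodule k (space X (vertex ε j) × space X (vertex ε (j + 1))) where
  carrier := {z | (∀ α : vertex ε j ⟶ vertex ε (j + 1), act X α z.1 = z.2) ∧
    ∀ α : vertex ε (j + 1) ⟶ vertex ε j, act X α z.2 = z.1}
  add_mem' hz hw := ⟨fun α => by simp [hz.1 α, hw.1 α], fun α => by simp [hz.2 α, hw.2 α]⟩
  zero_mem' := ⟨fun α => map_zero _, fun α => map_zero _⟩
  smul_mem' c z hz := ⟨fun α => by simp [hz.1 α], fun α => by simp [hz.2 α]⟩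

theorem mk_act_mem_edge {j : ℕ} (α : vertex ε j ⟶ vertex ε (j + 1)) (y) :
    (y, act X α y) ∈ edge X j :=
  ⟨fun β => by rw [Subsingleton.elim β α], fun β => (isEmpty_hom_of_hom α).elim β⟩

theorem act_mk_mem_edge {j : ℕ} (α : vertex ε (j + 1) ⟶ vertex ε j) (y) :
    (act X α y, y) ∈ edge X j :=
  ⟨fun β => (isEmpty_hom_of_hom α).elim β, fun β => by rw [Subsingleton.elim β α]⟩

theorem mem_edge_last (z) : z ∈ edge X (n + 1) := by
  have h : vertex ε (n + 2) = vertex ε (n + 1) := Fin.ext (by simp [vertex])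
  have h' (α : vertex ε (n + 1) ⟶ vertex ε (n + 1)) : False := (isEmpty_hom_of_hom α).elim α
  exact ⟨fun α => (h' (h ▸ α)).elim, fun α => (h' (h ▸ α)).elim⟩

theorem act_eq_zero_of_isSplitPair (h : IsSplitPair (edge X) a b x φ) (hab : a ≤ b)
    (α : vertex ε b ⟶ vertex ε (b + 1)) : act X α (x b) = 0 := by
  obtain hb | hb := h.terminates
  · exact hb.1 α
  · have := hb _ (mk_act_mem_edge α (x b))
    simp [h.pairing hab le_rfl] at this

theorem apply_act_eq_zero_of_isSplitPair (h : IsSplitPair (edge X) a b x φ) (hab : a ≤ b)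
    (α : vertex ε (b + 1) ⟶ vertex ε b) (y) : φ b (act X α y) = 0 := by
  obtain hb | hb := h.terminates
  · have hx : x b = 0 := (hb.2 α).symm.trans (map_zero _)
    have := h.pairing hab le_rfl
    simp [hx] at this
  · exact hb _ (act_mk_mem_edge α y)

theorem exists_hom_from_thin (h : IsSplitPair (edge X) a b x φ) (hab : a ≤ b)
    (h₀ : ∀ j < a, Subsingleton (space X (vertex ε j))) :
    ∃ f : thin k (interval ε a (b + 1)) ⟶ X, ∀ j < n + 2, a ≤ j → j ≤ b → ∀ c,
      lin f (vertex ε j) c = coord _ _ c • x j := by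
  obtain ⟨y, hy⟩ := exists_forall_vertex_eq fun j => if a ≤ j ∧ j ≤ b then x j else 0
  refine ⟨fromThin y (fun v hv => ?_) (fun α hs => ?_), fun j hj ha hb c => ?_⟩
  · obtain ⟨j, hj, rfl⟩ := exists_vertex_eq v
    rw [hy j hj, if_neg fun hj' => hv ((interval_vertex hj).2 ⟨hj'.1, by omega⟩)]
  · obtain ⟨j, hj, ⟨rfl, rfl, -⟩ | ⟨rfl, rfl, -⟩⟩ := exists_eq_vertex α
    all_goals
      rw [interval_vertex (by omega)] at hs
      rw [hy j (by omega), hy (j + 1) (by omega), if_pos (by omega)]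
    · obtain rfl | hjb := eq_or_lt_of_le (Nat.lt_succ_iff.1 hs.2)
      · rw [if_neg (by omega), act_eq_zero_of_isSplitPair h hab]
      · rw [if_pos (by omega), (h.mem_chains j hs.1 hjb).1 α]
    · obtain hja | haj := lt_or_ge j a
      · exact (h₀ j hja).elim _ _
      · rw [if_pos (by omega), (h.mem_chains j haj (by omega)).2 α]
  · rw [lin_fromThin, hy j hj, if_pos ⟨ha, hb⟩]

theorem exists_hom_to_thin (h : IsSplitPair (edge X) a b x φ) (hab : a ≤ b)
    (h₀ : ∀ j < a, Subsingleton (space X (vertex ε j))) :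
    ∃ g : X ⟶ thin k (interval ε a (b + 1)), ∀ j < n + 2, a ≤ j → j ≤ b → ∀ y,
      lin g (vertex ε j) y = pt _ _ (φ j y) := by
  obtain ⟨ψ, hψ⟩ := exists_forall_vertex_eq (F := fun v => Module.Dual k (space X v))
    fun j => if a ≤ j ∧ j ≤ b then φ j else 0
  refine ⟨toThin ψ (fun v hv => ?_) (fun α ht y => ?_), fun j hj ha hb y => ?_⟩
  · obtain ⟨j, hj, rfl⟩ := exists_vertex_eq v
    rw [hψ j hj, if_neg fun hj' => hv ((interval_vertex hj).2 ⟨hj'.1, by omega⟩)]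
  · obtain ⟨j, hj, ⟨rfl, rfl, -⟩ | ⟨rfl, rfl, -⟩⟩ := exists_eq_vertex α
    all_goals
      rw [interval_vertex (by omega)] at ht
      rw [hψ j (by omega), hψ (j + 1) (by omega), if_pos (by omega)]
    · obtain hja | haj := lt_or_ge j a
      · have := h₀ j hja
        rw [Subsingleton.elim y 0, map_zero, map_zero, map_zero]
      · rw [if_pos (by omega)]
        exact (h.isDualChain j haj (by omega) _ (mk_act_mem_edge α y)).symm
    · obtain rfl | hjb := eq_or_lt_of_le (Nat.lt_succ_iff.1 ht.2)
      · rw [if_neg (by omega), apply_act_eq_zero_of_isSplitPair h hab, LinearMap.zero_apply]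
      · rw [if_pos (by omega)]
        exact h.isDualChain j ht.1 hjb _ (act_mk_mem_edge α y)
  · rw [lin_toThin, hψ j hj, if_pos ⟨ha, hb⟩]

theorem isSummand_of_isSplitPair (h : IsSplitPair (edge X) a b x φ) (hab : a ≤ b)
    (h₀ : ∀ j < a, Subsingleton (space X (vertex ε j))) :
    IsSummand (thin k (interval ε a (b + 1))) X := by
  obtain ⟨f, hf⟩ := exists_hom_from_thin h hab h₀
  obtain ⟨g, hg⟩ := exists_hom_to_thin h hab h₀
  refine isSummand_iff.2 ⟨f, g, hom_ext fun v c => thin_ext fun hv => ?_⟩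
  obtain ⟨j, hj, rfl⟩ := exists_vertex_eq v
  obtain ⟨ha, hb⟩ := (interval_vertex hj).1 hv
  rw [lin_comp, hf j hj ha (by omega), hg j hj ha (by omega), map_smul,
    h.pairing ha (by omega), smul_eq_mul, mul_one, pt_coord, lin_id]

theorem exists_isSummand_chordRep (hX : ¬ IsZero X) : ∃ p, IsSummand (chordRep k ε p) X := by
  classical
  have hex : ∃ j, j < n + 2 ∧ Nontrivial (space X (vertex ε j)) := by
    obtain ⟨v, hv⟩ := not_isZero_iff.1 hX
    obtain ⟨j, hj, rfl⟩ := exists_vertex_eq v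
    exact ⟨j, hj, hv⟩
  obtain ⟨ha, _⟩ := Nat.find_spec hex
  have h₀ (j : ℕ) (hj : j < Nat.find hex) : Subsingleton (space X (vertex ε j)) :=
    not_nontrivial_iff_subsingleton.1 fun h => Nat.find_min hex hj ⟨by omega, h⟩
  obtain ⟨b, x, φ, hab, hb, h⟩ := exists_isSplitPair (ρ := edge X) (c := n + 1)
    (Nat.lt_succ_iff.1 ha) fun y => mem_edge_last _
  exact ⟨⟨(_, b + 1), Nat.lt_succ_of_le hab, by simpa using hb⟩, isSummand_of_isSplitPair h hab h₀⟩

theorem eq_of_forall_interval_iff {p q : Chord n}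
    (h : ∀ v, interval ε p.1.1 p.1.2 v ↔ interval ε q.1.1 q.1.2 v) : p = q := by
  obtain ⟨⟨a, b⟩, hab, hb⟩ := p
  obtain ⟨⟨c, d⟩, hcd, hd⟩ := q
  dsimp only at hab hb hcd hd h
  have h' (j : ℕ) (hj : j < n + 2) : a ≤ j ∧ j < b ↔ c ≤ j ∧ j < d := by
    simpa only [interval_vertex hj] using h (vertex ε j)
  have := h' a (by omega)
  have := h' c (by omega)
  have := h' (b - 1) (by omega)
  have := h' (d - 1) (by omega)
  obtain ⟨rfl, rfl⟩ : a = c ∧ b = d := by omega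
  rfl

theorem isBrickSystem_chordRep : IsBrickSystem (chordRep k ε) where
  isBrick p := isBrick_thin (isConnectedSupport_interval p.2.1 p.2.2)
  comp_eq_zero {p q} hpq f g := by
    obtain ⟨v, hv⟩ := not_forall.1 fun h => hpq (eq_of_forall_interval_iff (ε := ε) h)
    exact thin_comp_eq_zero (isConnectedSupport_interval p.2.1 p.2.2)
      (isConnectedSupport_interval q.2.1 q.2.2) hv f g
  exists_isSummand _ := exists_isSummand_chordRep

end QuiverRep

/-! ### Triangulations of polygons -/

/-- The crossing of two segments between points on a circle, numbered along the circle. -/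
def Interleave (x y : ℕ × ℕ) : Prop :=
  x.1 < y.1 ∧ y.1 < x.2 ∧ x.2 < y.2 ∨ y.1 < x.1 ∧ x.1 < y.2 ∧ y.2 < x.2

theorem interleave_comm {x y : ℕ × ℕ} : Interleave x y ↔ Interleave y x := Or.comm

theorem not_interleave_self (x : ℕ × ℕ) : ¬ Interleave x x := by
  unfold Interleave
  omega

/-- The segments between the points `i, …, j`. -/
def segments (i j : ℕ) : Finset (ℕ × ℕ) :=
  (Finset.Icc i j ×ˢ Finset.Icc i j).filter fun x => x.1 < x.2

theorem mem_segments {i j : ℕ} {x : ℕ × ℕ} :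
    x ∈ segments i j ↔ i ≤ x.1 ∧ x.1 < x.2 ∧ x.2 ≤ j := by
  simp only [segments, Finset.mem_filter, Finset.mem_product, Finset.mem_Icc]
  omega

/-- A triangulation of the polygon with vertices `i, …, j`, encoded by its diagonals together with
the sides of the polygon: a maximal noncrossing set of segments. -/
structure IsTriangulation (i j : ℕ) (S : Finset (ℕ × ℕ)) : Prop where
  subset : S ⊆ segments i j
  not_interleave : ∀ x ∈ S, ∀ y ∈ S, ¬ Interleave x y
  mem : ∀ x ∈ segments i j, (∀ y ∈ S, ¬ Interleave x y) → x ∈ S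

/-- The set of segments obtained by placing `A` and `B` on two sides of a triangle with third side
from `i` to `j`. -/
def glue (i j : ℕ) (A B : Finset (ℕ × ℕ)) : Finset (ℕ × ℕ) := insert (i, j) (A ∪ B)

theorem mem_glue {i j : ℕ} {A B : Finset (ℕ × ℕ)} {x : ℕ × ℕ} :
    x ∈ glue i j A B ↔ x = (i, j) ∨ x ∈ A ∨ x ∈ B := by
  simp only [glue, Finset.mem_insert, Finset.mem_union]

namespace IsTriangulation

variable {i j m m' a b : ℕ} {S A B : Finset (ℕ × ℕ)} {x : ℕ × ℕ}

theorem bounds (h : IsTriangulation i j S) (hx : x ∈ S) : i ≤ x.1 ∧ x.1 < x.2 ∧ x.2 ≤ j :=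
  mem_segments.1 (h.subset hx)

theorem mem_of_forall_bounds (h : IsTriangulation i j S) (hx : x ∈ segments i j)
    (H : ∀ y : ℕ × ℕ, i ≤ y.1 → y.1 < y.2 → y.2 ≤ j → ¬ Interleave x y) : x ∈ S :=
  h.mem x hx fun y hy => H y (h.bounds hy).1 (h.bounds hy).2.1 (h.bounds hy).2.2

theorem side_mem (h : IsTriangulation i j S) (hij : i < j) : (i, j) ∈ S :=
  h.mem_of_forall_bounds (mem_segments.2 ⟨le_rfl, hij, le_rfl⟩) fun y _ _ _ => by
    unfold Interleave
    omega

theorem inter_segments (h : IsTriangulation i j S) (hab : (a, b) ∈ S) :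
    IsTriangulation a b (S ∩ segments a b) where
  subset := Finset.inter_subset_right
  not_interleave x hx y hy :=
    h.not_interleave x (Finset.mem_of_mem_inter_left hx) y (Finset.mem_of_mem_inter_left hy)
  mem x hx hS := by
    have hab' := h.bounds hab
    have hx' := mem_segments.1 hx
    dsimp only at hab'
    refine Finset.mem_inter.2 ⟨h.mem x (mem_segments.2 (by omega)) fun y hy => ?_, hx⟩
    by_cases hyab : y ∈ segments a b
    · exact hS y (Finset.mem_inter.2 ⟨hy, hyab⟩)
    · have hcross := h.not_interleave _ hab _ hy
      have hy' := h.bounds hy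
      rw [mem_segments] at hyab
      unfold Interleave at hcross ⊢
      dsimp only at hcross
      omega

theorem exists_apex (h : IsTriangulation i j S) (hij : i + 1 < j) :
    ∃ m, i < m ∧ m < j ∧ (i, m) ∈ S ∧ (m, j) ∈ S := by
  have hstart : (i, i + 1) ∈ S :=
    h.mem_of_forall_bounds (mem_segments.2 ⟨le_rfl, Nat.lt_succ_self i, hij.le⟩) fun y _ _ _ => by
      unfold Interleave
      omega
  obtain ⟨m, hm, hmax⟩ := ((Finset.Ioo i j).filter fun m => (i, m) ∈ S).exists_max_image id
    ⟨i + 1, Finset.mem_filter.2 ⟨Finset.mem_Ioo.2 ⟨Nat.lt_succ_self i, hij⟩, hstart⟩⟩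
  simp only [Finset.mem_filter, Finset.mem_Ioo, id] at hm hmax
  obtain ⟨⟨him, hmj⟩, hmS⟩ := hm
  refine ⟨m, him, hmj, hmS, h.mem _ (mem_segments.2 ⟨him.le, hmj, le_rfl⟩) fun y hy => ?_⟩
  have hlong : y.1 = i → m < y.2 → ¬ y.2 < j := fun hy₁ hy₂ hy₃ =>
    (hmax y.2 ⟨⟨by omega, hy₃⟩, hy₁ ▸ hy⟩).not_gt hy₂
  have hy' := h.bounds hy
  have hcross := h.not_interleave _ hmS _ hy
  unfold Interleave at hcross ⊢
  dsimp only at hcross ⊢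
  omega

theorem apex_unique (h : IsTriangulation i j S) (him : (i, m) ∈ S) (hmj : (m, j) ∈ S)
    (him' : (i, m') ∈ S) (hmj' : (m', j) ∈ S) : m = m' := by
  have h₁ := h.not_interleave _ him _ hmj'
  have h₂ := h.not_interleave _ him' _ hmj
  have := h.bounds him
  have := h.bounds hmj
  have := h.bounds him'
  have := h.bounds hmj'
  unfold Interleave at h₁ h₂
  dsimp only at *
  omega

theorem glue_inter_segments (h : IsTriangulation i j S) (him : (i, m) ∈ S) (hmj : (m, j) ∈ S) :
    glue i j (S ∩ segments i m) (S ∩ segments m j) = S := by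
  have hi := h.bounds him
  have hj := h.bounds hmj
  dsimp only at hi hj
  ext x
  simp only [mem_glue, Finset.mem_inter, mem_segments]
  refine ⟨?_, fun hx => ?_⟩
  · rintro (rfl | hx | hx)
    · exact h.side_mem (by omega)
    · exact hx.1
    · exact hx.1
  · have hx' := h.bounds hx
    have hxi := h.not_interleave _ him _ hx
    have hxj := h.not_interleave _ hmj _ hx
    unfold Interleave at hxi hxj
    simp only [Prod.ext_iff, hx, true_and]
    dsimp only at hxi hxj
    omega

theorem glue_inter_left (hmj : m < j) (hA : IsTriangulation i m A)
    (hB : IsTriangulation m j B) : glue i j A B ∩ segments i m = A := by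
  ext x
  simp only [Finset.mem_inter, mem_glue, mem_segments]
  refine ⟨?_, fun hx => ⟨Or.inr (Or.inl hx), hA.bounds hx⟩⟩
  rintro ⟨rfl | hx | hx, h⟩
  · dsimp only at h
    omega
  · exact hx
  · have := hB.bounds hx
    omega

theorem glue_inter_right (him : i < m) (hA : IsTriangulation i m A)
    (hB : IsTriangulation m j B) : glue i j A B ∩ segments m j = B := by
  ext x
  simp only [Finset.mem_inter, mem_glue, mem_segments]
  refine ⟨?_, fun hx => ⟨Or.inr (Or.inr hx), hB.bounds hx⟩⟩
  rintro ⟨rfl | hx | hx, h⟩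
  · dsimp only at h
    omega
  · have := hA.bounds hx
    omega
  · exact hx

section Glue

variable (him : i < m) (hmj : m < j) (hA : IsTriangulation i m A) (hB : IsTriangulation m j B)
include him hmj hA hB

theorem glue_not_interleave {y : ℕ × ℕ} (hx : x ∈ glue i j A B) (hy : y ∈ glue i j A B) :
    ¬ Interleave x y := by
  rw [mem_glue] at hx hy
  rcases hx with rfl | hx | hx <;> rcases hy with rfl | hy | hy
  case inr.inl.inr.inl => exact hA.not_interleave x hx y hy
  case inr.inr.inr.inr => exact hB.not_interleave x hx y hy
  all_goals
    unfold Interleave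
    try have := hA.bounds hx
    try have := hB.bounds hx
    try have := hA.bounds hy
    try have := hB.bounds hy
    grind

protected theorem glue : IsTriangulation i j (glue i j A B) where
  subset x hx := by
    rw [mem_segments]
    obtain rfl | hx | hx := mem_glue.1 hx
    · exact ⟨le_rfl, him.trans hmj, le_rfl⟩
    · have := hA.bounds hx
      omega
    · have := hB.bounds hx
      omega
  not_interleave x hx y hy := glue_not_interleave him hmj hA hB hx hy
  mem x hx h := by
    simp only [mem_glue] at h ⊢
    by_cases hxA : x ∈ segments i m
    · exact Or.inr (Or.inl (hA.mem x hxA fun y hy => h y (Or.inr (Or.inl hy))))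
    by_cases hxB : x ∈ segments m j
    · exact Or.inr (Or.inr (hB.mem x hxB fun y hy => h y (Or.inr (Or.inr hy))))
    have hi := h _ (Or.inr (Or.inl (hA.side_mem him)))
    have hj := h _ (Or.inr (Or.inr (hB.side_mem hmj)))
    rw [mem_segments] at hx hxA hxB
    unfold Interleave at hi hj
    simp only [Prod.ext_iff]
    dsimp only at hi hj
    omega

theorem card_glue : (glue i j A B).card = A.card + B.card + 1 := by
  rw [glue, Finset.card_insert_of_notMem, Finset.card_union_of_disjoint]
  · refine Finset.disjoint_left.2 fun x hxA hxB => ?_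
    have := hA.bounds hxA
    have := hB.bounds hxB
    omega
  · intro hx
    obtain hx | hx := Finset.mem_union.1 hx
    · exact hmj.not_ge (hA.bounds hx).2.2
    · exact him.not_ge (hB.bounds hx).1

end Glue

theorem exists_glue_eq (h : IsTriangulation i j S) (hij : i + 1 < j) :
    ∃ m A B, i < m ∧ m < j ∧ IsTriangulation i m A ∧ IsTriangulation m j B ∧ glue i j A B = S := by
  obtain ⟨m, him, hmj, hi, hj⟩ := h.exists_apex hij
  exact ⟨m, _, _, him, hmj, h.inter_segments hi, h.inter_segments hj, h.glue_inter_segments hi hj⟩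

end IsTriangulation

theorem isTriangulation_succ_iff {i : ℕ} {S : Finset (ℕ × ℕ)} :
    IsTriangulation i (i + 1) S ↔ S = {(i, i + 1)} := by
  have hsegments : segments i (i + 1) = {(i, i + 1)} := by
    ext x
    rw [mem_segments, Finset.mem_singleton, Prod.ext_iff]
    dsimp only
    omega
  constructor
  · intro h
    exact Finset.Subset.antisymm (hsegments ▸ h.subset)
      (Finset.singleton_subset_iff.2 (h.side_mem (Nat.lt_succ_self i)))
  · rintro rfl
    refine ⟨hsegments.ge, fun x hx y hy => ?_, fun x hx _ => hsegments ▸ hx⟩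
    rw [Finset.mem_singleton.1 hx, Finset.mem_singleton.1 hy]
    exact not_interleave_self _

theorem IsTriangulation.card_add_one {i j : ℕ} {S : Finset (ℕ × ℕ)} (h : IsTriangulation i j S)
    (hij : i < j) : S.card + 1 = 2 * (j - i) := by
  induction hd : j - i using Nat.strong_induction_on generalizing i j S with
  | _ d ih =>
    obtain rfl | hij := eq_or_lt_of_le (Nat.succ_le_of_lt hij)
    · obtain rfl := isTriangulation_succ_iff.1 h
      rw [Finset.card_singleton]
      omega
    · obtain ⟨m, A, B, him, hmj, hA, hB, rfl⟩ := h.exists_glue_eq hij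
      have hcardA := ih (m - i) (by omega) hA him rfl
      have hcardB := ih (j - m) (by omega) hB hmj rfl
      rw [card_glue him hmj hA hB]
      omega

open scoped Classical in
/-- The triangulations of the polygon with vertices `i, …, j`. -/
noncomputable def triangulations (i j : ℕ) : Finset (Finset (ℕ × ℕ)) :=
  (segments i j).powerset.filter (IsTriangulation i j)

theorem mem_triangulations {i j : ℕ} {S : Finset (ℕ × ℕ)} :
    S ∈ triangulations i j ↔ IsTriangulation i j S := by
  simp only [triangulations, Finset.mem_filter, Finset.mem_powerset, and_iff_right_iff_imp]
  exact fun h => h.subset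

/-- The triangulations of the polygon with vertices `i, …, j` in which the triangle at the side from
`i` to `j` has the third vertex `m`. -/
noncomputable def triangulationsWithApex (i j m : ℕ) : Finset (Finset (ℕ × ℕ)) :=
  (triangulations i m ×ˢ triangulations m j).image fun p => glue i j p.1 p.2

theorem mem_triangulationsWithApex {i j m : ℕ} {S : Finset (ℕ × ℕ)} :
    S ∈ triangulationsWithApex i j m ↔
      ∃ A B, IsTriangulation i m A ∧ IsTriangulation m j B ∧ glue i j A B = S := by
  simp only [triangulationsWithApex, Finset.mem_image, Finset.mem_product, mem_triangulations,
    Prod.exists, and_assoc]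

section Count

variable {i j m : ℕ}

theorem triangulations_eq_biUnion (hij : i + 1 < j) :
    triangulations i j = (Finset.Ioo i j).biUnion (triangulationsWithApex i j) := by
  ext S
  simp only [Finset.mem_biUnion, mem_triangulationsWithApex, mem_triangulations, Finset.mem_Ioo]
  constructor
  · intro h
    obtain ⟨m, A, B, him, hmj, hAB⟩ := h.exists_glue_eq hij
    exact ⟨m, ⟨him, hmj⟩, A, B, hAB⟩
  · rintro ⟨m, ⟨him, hmj⟩, A, B, hA, hB, rfl⟩
    exact hA.glue him hmj hB

theorem pairwiseDisjoint_triangulationsWithApex :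
    (Finset.Ioo i j : Set ℕ).PairwiseDisjoint (triangulationsWithApex i j) := by
  intro m hm m' hm' hne
  rw [Finset.coe_Ioo] at hm hm'
  refine Finset.disjoint_left.2 fun S hS hS' => hne ?_
  obtain ⟨A, B, hA, hB, rfl⟩ := mem_triangulationsWithApex.1 hS
  obtain ⟨A', B', hA', hB', h⟩ := mem_triangulationsWithApex.1 hS'
  refine (hA.glue hm.1 hm.2 hB).apex_unique (mem_glue.2 (Or.inr (Or.inl (hA.side_mem hm.1))))
    (mem_glue.2 (Or.inr (Or.inr (hB.side_mem hm.2)))) ?_ ?_ <;> rw [← h]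
  · exact mem_glue.2 (Or.inr (Or.inl (hA'.side_mem hm'.1)))
  · exact mem_glue.2 (Or.inr (Or.inr (hB'.side_mem hm'.2)))

theorem card_triangulationsWithApex (him : i < m) (hmj : m < j) :
    (triangulationsWithApex i j m).card =
      (triangulations i m).card * (triangulations m j).card := by
  rw [triangulationsWithApex, Finset.card_image_of_injOn, Finset.card_product]
  rintro ⟨A, B⟩ hAB ⟨A', B'⟩ hAB' h
  simp only [Finset.coe_product, Set.mem_prod, Finset.mem_coe, mem_triangulations] at hAB hAB'
  dsimp only at h
  refine Prod.ext ?_ ?_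
  · rw [← IsTriangulation.glue_inter_left hmj hAB.1 hAB.2, h,
      IsTriangulation.glue_inter_left hmj hAB'.1 hAB'.2]
  · rw [← IsTriangulation.glue_inter_right him hAB.1 hAB.2, h,
      IsTriangulation.glue_inter_right him hAB'.1 hAB'.2]

theorem sum_Ioo_catalan_mul_catalan (hij : i + 1 < j) :
    ∑ m ∈ Finset.Ioo i j, catalan (m - i - 1) * catalan (j - m - 1) = catalan (j - i - 1) := by
  obtain ⟨N, rfl⟩ := Nat.exists_eq_add_of_lt hij
  rw [show i + 1 + N + 1 - i - 1 = N + 1 by omega, catalan_succ']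
  refine Finset.sum_nbij' (fun m => (m - i - 1, i + 1 + N + 1 - m - 1)) (fun p => i + p.1 + 1)
    ?_ ?_ ?_ ?_ ?_
  · intro m hm
    rw [Finset.mem_Ioo] at hm
    rw [Finset.HasAntidiagonal.mem_antidiagonal]
    omega
  · intro p hp
    rw [Finset.HasAntidiagonal.mem_antidiagonal] at hp
    rw [Finset.mem_Ioo]
    omega
  · intro m hm
    rw [Finset.mem_Ioo] at hm
    omega
  · intro p hp
    rw [Finset.HasAntidiagonal.mem_antidiagonal] at hp
    ext <;> omega
  · exact fun m _ => rfl

theorem card_triangulations (hij : i < j) : (triangulations i j).card = catalan (j - i - 1) := by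
  induction hd : j - i using Nat.strong_induction_on generalizing i j with
  | _ d ih =>
    obtain rfl | hij := eq_or_lt_of_le (Nat.succ_le_of_lt hij)
    · have : triangulations i (i + 1) = {{(i, i + 1)}} := by
        ext S
        rw [mem_triangulations, isTriangulation_succ_iff, Finset.mem_singleton]
      rw [this, Finset.card_singleton, show d - 1 = 0 by omega, catalan_zero]
    · rw [triangulations_eq_biUnion hij,
        Finset.card_biUnion pairwiseDisjoint_triangulationsWithApex, ← hd,
        ← sum_Ioo_catalan_mul_catalan hij]
      refine Finset.sum_congr rfl fun m hm => ?_
      obtain ⟨him, hmj⟩ := Finset.mem_Ioo.1 hm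
      rw [card_triangulationsWithApex him hmj, ih (m - i) (by omega) him rfl,
        ih (j - m) (by omega) hmj rfl]

end Count

section Transport

variable {α : Type*} {f : α → ℕ × ℕ} {i j : ℕ}

theorem setOf_maximal_isNoncrossing (hf : Function.Injective f)
    (hrange : Set.range f = segments i j) :
    {S : Set α | Maximal (IsNoncrossing fun x y => Interleave (f x) (f y)) S} =
      (fun T : Finset (ℕ × ℕ) => f ⁻¹' T) '' triangulations i j := by
  classical
  have hmem (x : α) : f x ∈ segments i j := (Set.ext_iff.1 hrange (f x)).1 ⟨x, rfl⟩
  ext S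
  simp only [Set.mem_ofPred_eq, Set.mem_image, Finset.mem_coe, mem_triangulations]
  constructor
  · intro hS
    refine ⟨(segments i j).filter (· ∈ f '' S),
      ⟨Finset.filter_subset _ _, ?_, fun x hx h => ?_⟩, ?_⟩
    · intro x hx y hy
      obtain ⟨a, ha, rfl⟩ := (Finset.mem_filter.1 hx).2
      obtain ⟨b, hb, rfl⟩ := (Finset.mem_filter.1 hy).2
      exact hS.prop a ha b hb
    · obtain ⟨x, rfl⟩ := (Set.ext_iff.1 hrange x).2 hx
      have hxS (y : α) (hy : y ∈ S) : ¬ Interleave (f x) (f y) :=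
        h _ (Finset.mem_filter.2 ⟨hmem y, y, hy, rfl⟩)
      refine Finset.mem_filter.2 ⟨hx, x, hS.mem_of_prop_insert ?_, rfl⟩
      rintro y (rfl | hy) z (rfl | hz)
      · exact not_interleave_self _
      · exact hxS z hz
      · exact fun hyz => hxS y hy (interleave_comm.1 hyz)
      · exact hS.prop y hy z hz
    · ext x
      simp [hmem, hf.eq_iff]
  · rintro ⟨T, hT, rfl⟩
    refine ⟨fun x hx y hy => hT.not_interleave _ hx _ hy, fun S hS hTS x hx => ?_⟩
    refine hT.mem _ (hmem x) fun y hy => ?_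
    obtain ⟨y, rfl⟩ := (Set.ext_iff.1 hrange y).2 (hT.subset hy)
    exact hS x hx y (hTS hy)

theorem ncard_add_one_of_maximal_isNoncrossing (hf : Function.Injective f)
    (hrange : Set.range f = segments i j) (hij : i < j) {S : Set α}
    (hS : Maximal (IsNoncrossing fun x y => Interleave (f x) (f y)) S) :
    S.ncard + 1 = 2 * (j - i) := by
  obtain ⟨T, hT, rfl⟩ := (Set.ext_iff.1 (setOf_maximal_isNoncrossing hf hrange) S).1 hS
  have hT := mem_triangulations.1 hT
  rw [← hT.card_add_one hij, Set.ncard_preimage_of_injective_subset_range hf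
    (hrange ▸ Finset.coe_subset.2 hT.subset), Set.ncard_coe_finset]

theorem ncard_setOf_maximal_isNoncrossing (hf : Function.Injective f)
    (hrange : Set.range f = segments i j) (hij : i < j) :
    {S : Set α | Maximal (IsNoncrossing fun x y => Interleave (f x) (f y)) S}.ncard =
      catalan (j - i - 1) := by
  rw [setOf_maximal_isNoncrossing hf hrange, ← card_triangulations hij, Set.InjOn.ncard_image,
    Set.ncard_coe_finset]
  intro S hS T hT h
  have hsub {S : Finset (ℕ × ℕ)} (hS : S ∈ triangulations i j) : (S : Set (ℕ × ℕ)) ⊆ Set.range f :=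
    hrange ▸ Finset.coe_subset.2 (mem_triangulations.1 hS).subset
  exact Finset.coe_injective ((Set.preimage_eq_preimage' (hsub hS) (hsub hT)).1 h)

end Transport

/-! ### The order of the vertices along the boundary -/

/-- The position of a vertex along the boundary of the polygon with vertices `0, …, N`: those below
from left to right, then those above, given by `U`, from right to left. -/
noncomputable def boundaryPosition (N : ℕ) (U : ℕ → Prop) (t : ℕ) : ℕ :=
  open scoped Classical in if U t then 2 * N - t else t

theorem injOn_boundaryPosition {N : ℕ} {U : ℕ → Prop} (hN : ¬ U N) :
    Set.InjOn (boundaryPosition N U) (Set.Iic N) := by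
  intro s hs t ht h
  have hsN : U s → s ≠ N := fun h e => hN (e ▸ h)
  have htN : U t → t ≠ N := fun h e => hN (e ▸ h)
  rw [Set.mem_Iic] at hs ht
  unfold boundaryPosition at h
  grind

/-- The segment between the images of the ends of a chord. -/
def mapSegment (r : ℕ → ℕ) (p : ℕ × ℕ) : ℕ × ℕ := (r p.1 ⊓ r p.2, r p.1 ⊔ r p.2)

theorem interleave_mapSegment_iff {N : ℕ} {r g : ℕ → ℕ}
    (hr : ∀ s ≤ N, ∀ t ≤ N, r s < r t ↔ g s < g t) {p q : ℕ × ℕ} (hp₁ : p.1 ≤ N) (hp₂ : p.2 ≤ N)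
    (hq₁ : q.1 ≤ N) (hq₂ : q.2 ≤ N) :
    Interleave (mapSegment r p) (mapSegment r q) ↔
      Interleave (mapSegment g p) (mapSegment g q) := by
  simp only [Interleave, mapSegment, lt_inf_iff, inf_lt_iff, lt_sup_iff, sup_lt_iff,
    hr _ hp₁ _ hq₁, hr _ hp₁ _ hq₂, hr _ hp₂ _ hq₁, hr _ hp₂ _ hq₂,
    hr _ hq₁ _ hp₁, hr _ hq₁ _ hp₂, hr _ hq₂ _ hp₁, hr _ hq₂ _ hp₂]

theorem exists_bijOn_Iic_lt_iff_lt {α : Type*} [LinearOrder α] {N : ℕ} {g : ℕ → α}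
    (hg : Set.InjOn g (Set.Iic N)) :
    ∃ r : ℕ → ℕ, Set.BijOn r (Set.Iic N) (Set.Iic N) ∧
      ∀ s ≤ N, ∀ t ≤ N, r s < r t ↔ g s < g t := by
  let below (t : ℕ) : Finset ℕ := (Finset.Iic N).filter fun s => g s < g t
  have hmono {s t : ℕ} (h : g s ≤ g t) : below s ⊆ below t :=
    Finset.monotone_filter_right _ fun _ _ ha => ha.trans_le h
  have hlt : ∀ s ≤ N, ∀ t ≤ N, (below s).card < (below t).card ↔ g s < g t := by
    refine fun s hs t _ => ⟨fun h => ?_, fun h => Finset.card_lt_card ?_⟩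
    · by_contra! hts
      exact h.not_ge (Finset.card_le_card (hmono hts))
    · refine (Finset.ssubset_iff_of_subset (hmono h.le)).2 ⟨s, ?_, ?_⟩ <;> simp [below, hs, h]
  have hmaps : Set.MapsTo (fun t => (below t).card) (Set.Iic N) (Set.Iic N) := by
    intro t ht
    have hss : below t ⊂ Finset.Iic N := Finset.filter_ssubset.2 ⟨t, by simpa using ht, lt_irrefl _⟩
    have := Finset.card_lt_card hss
    rw [Nat.card_Iic] at this
    exact Nat.le_of_lt_succ this
  have hinj : Set.InjOn (fun t => (below t).card) (Set.Iic N) := fun s hs t ht h =>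
    hg hs ht (le_antisymm (not_lt.1 fun hts => ((hlt t ht s hs).2 hts).ne' h)
      (not_lt.1 fun hst => ((hlt s hs t ht).2 hst).ne h))
  refine ⟨fun t => (below t).card, ⟨hmaps, hinj, ?_⟩, hlt⟩
  have := Finset.surjOn_of_injOn_of_card_le (s := Finset.Iic N) (t := Finset.Iic N)
    (fun t => (below t).card) (by simpa using hmaps) (by simpa using hinj) le_rfl
  simpa using this

namespace QuiverRep

variable {n : ℕ}

theorem mapSegment_injective {r : ℕ → ℕ} (hr : Set.InjOn r (Set.Iic (n + 2))) :
    Function.Injective fun p : Chord n => mapSegment r p := by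
  rintro ⟨⟨a, b⟩, hab, hb⟩ ⟨⟨c, d⟩, hcd, hd⟩ h
  dsimp only at hab hb hcd hd
  have hac : r a = r c ↔ a = c := hr.eq_iff (by simp; omega) (by simp; omega)
  have had : r a = r d ↔ a = d := hr.eq_iff (by simp; omega) (by simp; omega)
  have hbc : r b = r c ↔ b = c := hr.eq_iff (by simp; omega) (by simp; omega)
  have hbd : r b = r d ↔ b = d := hr.eq_iff (by simp; omega) (by simp; omega)
  simp only [mapSegment, Prod.mk.injEq] at h
  simp only [Subtype.mk.injEq, Prod.mk.injEq]
  omega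

theorem range_mapSegment {r : ℕ → ℕ} (hr : Set.BijOn r (Set.Iic (n + 2)) (Set.Iic (n + 2))) :
    (Set.range fun p : Chord n => mapSegment r p) = segments 0 (n + 2) := by
  ext ⟨x, y⟩
  simp only [Set.mem_range, Finset.mem_coe, mem_segments, mapSegment, Prod.mk.injEq]
  constructor
  · rintro ⟨⟨⟨a, b⟩, hab, hb⟩, rfl, rfl⟩
    dsimp only at hab hb
    have ha : a ≤ n + 2 := hab.le.trans hb
    exact ⟨Nat.zero_le _, inf_lt_sup.2 fun h => hab.ne (hr.injOn ha hb h),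
      sup_le (hr.mapsTo ha) (hr.mapsTo hb)⟩
  · rintro ⟨-, hxy, hy⟩
    obtain ⟨s, hs, rfl⟩ := hr.surjOn (Set.mem_Iic.2 (hxy.le.trans hy))
    obtain ⟨t, ht, rfl⟩ := hr.surjOn (Set.mem_Iic.2 hy)
    obtain hst | rfl | hts := lt_trichotomy s t
    · exact ⟨⟨(s, t), hst, ht⟩, inf_of_le_left hxy.le, sup_of_le_right hxy.le⟩
    · exact absurd hxy (lt_irrefl _)
    · exact ⟨⟨(t, s), hts, hs⟩, inf_of_le_right hxy.le, sup_of_le_left hxy.le⟩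

theorem crosses_iff_interleave {U : ℕ → Prop} (h₀ : ¬ U 0) (hN : ¬ U (n + 2)) (p q : Chord n) :
    Crosses U p q ↔ Interleave (mapSegment (boundaryPosition (n + 2) U) p)
      (mapSegment (boundaryPosition (n + 2) U) q) := by
  obtain ⟨⟨a, b⟩, hab, hb⟩ := p
  obtain ⟨⟨c, d⟩, hcd, hd⟩ := q
  dsimp only at hab hb hcd hd
  have hac : a = c → (U a ↔ U c) := fun h => h ▸ Iff.rfl
  have had : a = d → (U a ↔ U d) := fun h => h ▸ Iff.rfl
  have hbc : b = c → (U b ↔ U c) := fun h => h ▸ Iff.rfl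
  have hbd : b = d → (U b ↔ U d) := fun h => h ▸ Iff.rfl
  have ha₀ : U a → a ≠ 0 := fun h e => h₀ (e ▸ h)
  have hc₀ : U c → c ≠ 0 := fun h e => h₀ (e ▸ h)
  have hbN : U b → b ≠ n + 2 := fun h e => hN (e ▸ h)
  have hdN : U d → d ≠ n + 2 := fun h e => hN (e ▸ h)
  unfold Crosses Traverses Interleave mapSegment boundaryPosition
  dsimp only
  generalize U a = A at *
  generalize U b = B at *
  generalize U c = C at *
  generalize U d = D at *
  by_cases hA : A <;> by_cases hB : B <;> by_cases hC : C <;> by_cases hD : D <;>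
    simp only [hA, hB, hC, hD, if_true, if_false, iff_true, iff_false, not_true, not_false_iff,
      imp_false, false_and, and_true, and_false, or_false, false_or, true_imp_iff,
      false_imp_iff, false_iff, implies_true] at * <;> omega

theorem exists_crosses_iff_interleave {U : ℕ → Prop} (h₀ : ¬ U 0) (hN : ¬ U (n + 2)) :
    ∃ f : Chord n → ℕ × ℕ, Function.Injective f ∧ Set.range f = segments 0 (n + 2) ∧
      ∀ p q, Crosses U p q ↔ Interleave (f p) (f q) := by
  obtain ⟨r, hr, hlt⟩ := exists_bijOn_Iic_lt_iff_lt (injOn_boundaryPosition hN)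
  refine ⟨fun p => mapSegment r p, mapSegment_injective hr.injOn, range_mapSegment hr,
    fun p q => (crosses_iff_interleave h₀ hN p q).trans
      (interleave_mapSegment_iff hlt ?_ ?_ ?_ ?_).symm⟩
  exacts [p.2.1.le.trans p.2.2, p.2.2, q.2.1.le.trans q.2.2, q.2.2]

instance : Finite (Chord n) :=
  (segments 0 (n + 2)).finite_toSet.subset fun _ hp =>
    Finset.mem_coe.2 (mem_segments.2 ⟨Nat.zero_le _, hp⟩)

end QuiverRep

namespace TypeA

variable {n : ℕ} {ε : Fin (n + 1) → Bool}

theorem not_isUpper_zero : ¬ IsUpper ε 0 := by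
  simp [IsUpper]

theorem not_isUpper_last : ¬ IsUpper ε (n + 2) := by
  rintro ⟨i, h, -⟩
  omega

end TypeA

theorem catalan_succ_eq_choose_div (n : ℕ) :
    (catalan (n + 1) : ℚ) = ((2 * n + 2).choose (n + 1) : ℚ) / ((n : ℚ) + 2) := by
  rw [eq_div_iff (by positivity)]
  have h := succ_mul_catalan_eq_centralBinom (n + 1)
  rw [Nat.centralBinom, mul_comm, show 2 * (n + 1) = 2 * n + 2 by ring] at h
  exact_mod_cast h

theorem mainTheorem4_general (k : Type u) [Field k] (n : ℕ) (ε : Fin (n + 1) → Bool) :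
    (∀ T : QuiverRep k (TypeA n ε), QuiverRep.IsMaximalAlmostRigid T →
      T.IsSumOfIndecomposables (2 * n + 3) ∧
      ∀ m : ℕ, T.IsSumOfIndecomposables m → m = 2 * n + 3) ∧
    Nat.card (QuiverRep.mar k (TypeA n ε)) = catalan (n + 1) ∧
    (Nat.card (QuiverRep.mar k (TypeA n ε)) : ℚ) =
      ((2 * n + 2).choose (n + 1) : ℚ) / ((n : ℚ) + 2) := by
  have hM : QuiverRep.IsBrickSystem (QuiverRep.chordRep k ε) := QuiverRep.isBrickSystem_chordRep
  obtain ⟨f, hf, hrange, hcross⟩ := QuiverRep.exists_crosses_iff_interleave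
    (TypeA.not_isUpper_zero (ε := ε)) TypeA.not_isUpper_last
  have hclique : QuiverRep.IsExtClique (QuiverRep.chordRep k ε) =
      IsNoncrossing fun p q => Interleave (f p) (f q) := by
    simp only [QuiverRep.isExtClique_chordRep hM, ← hcross]
  have hcard : Nat.card (QuiverRep.mar k (TypeA n ε)) = catalan (n + 1) := by
    rw [hM.card_mar, hclique]
    exact ncard_setOf_maximal_isNoncrossing hf hrange (by omega)
  refine ⟨fun T hT => ?_, hcard, hcard ▸ catalan_succ_eq_choose_div n⟩
  obtain ⟨S, hS, hsum⟩ := hM.exists_isSumOfIndecomposables_iff hT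
  rw [hclique] at hS
  have hncard := ncard_add_one_of_maximal_isNoncrossing hf hrange (by omega) hS
  have hncard' : S.ncard = 2 * n + 3 := by omega
  exact ⟨(hsum _).2 hncard'.symm, fun m hm => ((hsum m).1 hm).trans hncard'⟩

theorem mainTheorem4 (k : Type u) [Field k] [IsAlgClosed k] (n : ℕ) (ε : Fin (n + 1) → Bool) :
    (∀ T : QuiverRep k (TypeA n ε), QuiverRep.IsMaximalAlmostRigid T →
      T.IsSumOfIndecomposables (2 * n + 3) ∧
      ∀ m : ℕ, T.IsSumOfIndecomposables m → m = 2 * n + 3) ∧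
    Nat.card (QuiverRep.mar k (TypeA n ε)) = catalan (n + 1) ∧
    (Nat.card (QuiverRep.mar k (TypeA n ε)) : ℚ) =
      ((2 * n + 2).choose (n + 1) : ℚ) / ((n : ℚ) + 2) :=
  mainTheorem4_general k n ε
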